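/- Let $F$ be a non-archimedean local field and $\theta$ a nontrivial continuous unitary character of $(F,+)$. For $m\ge 1$ put $G_m=GL(m,F)$; let $P_m\subset G_m$ be the subgroup of matrices with last row $(0,\dots,0,1)$ (so $P_1$ is trivial) and, for $m\geq 2$, let $U_m\subset P_m$ be the subgroup of matrices $\begin{pmatrix} I_{m-1}&x\\0&1\end{pmatrix}$, $x\in F^{m-1}$; view $P_{m-1}\subset G_{m-1}$ inside $P_m$ by $g\mapsto \mathrm{diag}(g,1)$. For $m\ge 2$ and a smooth complex representation $\sigma$ of $P_{m-1}$, let $$\Phi^+\sigma=\mathrm{ind}_{P_{m-1}U_m}^{P_m}\big(\delta_{U_m}^{1/2}\sigma\otimes\theta\big),$$ where $\mathrm{ind}$ is (unnormalized) compact induction: functions $f$ with $f(hg)=\rho(h)f(g)$, fixed under right translation by an open subgroup and with support compact modulo the inducing subgroup, on which the group acts by right translation. Here $\theta$ is the character $u\mapsto\theta(u_{m-1,m})$ of $U_m$, extended trivially to $P_{m-1}$, and $\delta_{U_m}$ is the modulus of conjugation on $U_m$: $\int_{U_m} f(y^{-1}uy)\,du=\delta_{U_m}(y)\int_{U_m}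 f(u)\,du$. Let $p\ge q\ge 1$ be integers with $n=p+q\ge 3$. Let $w_{p,q}$ be the permutation of $\{1,\dots,n\}$ that sends $i\mapsto i$ for $1\le i\le p-q+1$, $p-q+1+j\mapsto p-q+1+2j$ for $0\le j\le q-1$, and $p+j\mapsto p-q+2j$ for $1\le j\le q$; let $w_{p,q-1}$ be its restriction to $\{1,\dots,n-1\}$, and $w_{p-1,q-1}$ the permutation of $\{1,\dots,n-2\}$ given by the same formulas with $(p-1,q-1)$ in place of $(p,q)$ (the identity when $q=1$). Identify a permutation $w$ with the matrix such that $we_j=e_{w(j)}$. Let $H_{p,q-1}=w_{p,q-1}M_{(p,q-1)}w_{p,q-1}^{-1}\subset G_{n-1}$ and $H_{p-1,q-1}=w_{p-1,q-1}M_{(p-1,q-1)}w_{p-1,q-1}^{-1}\subset G_{n-2}$, where $M_{(a,b)}\subset G_{a+b}$ is the group of block diagonal matrices with blocks of sizes $a$ and $b$. A positive character of a topological group is a continuous homomorphism to $\mathbb R_{>0}$; for a representation $\pi$ of a group $P$ and a character $\chi$ of a subgroup $K$ of $P$, $\mathrm{Hom}_K(\pi,\chi)$ is the complex vector space of linear forms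 $\ell$ on the space of $\pi$ with $\ell(\pi(h)v)=\chi(h)\ell(v)$ for all $h\in K$ and all $v$. Then for every smooth complex representation $\sigma'$ of $P_{n-2}$ and every positive character $\chi'$ of $P_{n-1}\cap H_{p,q-1}$ there is a positive character $\chi''$ of $P_{n-2}\cap H_{p-1,q-1}$ for which there exists an injective $\mathbb C$-linear map $$\mathrm{Hom}_{P_{n-1}\cap H_{p,q-1}}(\Phi^+\sigma',\chi')\hookrightarrow \mathrm{Hom}_{P_{n-2}\cap H_{p-1,q-1}}(\sigma',\chi'').$$ -/

import Mathlib

open scoped NNReal MatrixGroups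

noncomputable section

namespace PAdic

/-! ### Smooth representations, positive characters, compact induction -/

section General

variable {G : Type*} [Group G] [TopologicalSpace G] {V : Type*} [AddCommGroup V] [Module ℂ V]

/-- A complex representation is smooth if every vector is fixed by an open subgroup. -/
def IsSmoothRep (π : Representation ℂ G V) : Prop :=
  ∀ v : V, ∃ K : Subgroup G, IsOpen (K : Set G) ∧ ∀ k ∈ K, π k v = v

/-- A positive character of `G`: a continuous homomorphism from `G` to the group of positive
real numbers. -/
structure PosChar (G : Type*) [Group G] [TopologicalSpace G] where
  toHom : G →* ℝ
  pos : ∀ g, 0 < toHom g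
  continuous_toHom : Continuous toHom

/-- `Hom_{A ∩ B}(π, χ)` for a representation `π` of `A` and a character `χ` of `A ∩ B`: the linear
forms `ℓ` with `ℓ (π(h) v) = χ(h) ℓ(v)` for `h ∈ A ∩ B`. -/
def homChar {A B : Subgroup G} (π : Representation ℂ A V) (χ : PosChar ↥(A ⊓ B)) :
    Submodule ℂ (Module.Dual ℂ V) where
  carrier := {l | ∀ (h : ↥(A ⊓ B)) (v : V),
    l (π (Subgroup.inclusion inf_le_left h) v) = (χ.toHom h : ℂ) * l v}
  add_mem' {a b} ha hb h v := by
    simp only [LinearMap.add_apply, ha h v, hb h v, mul_add]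
  zero_mem' h v := by simp
  smul_mem' c a ha h v := by
    simp only [LinearMap.smul_apply, ha h v, smul_eq_mul]
    ring

variable [IsTopologicalGroup G]

/-- The space of the compactly induced representation `ind_H^G ρ`: functions `f : G → V` with
`f (h g) = ρ(h) f(g)`, fixed under right translation by some open subgroup, with support compact
modulo `H`, i.e. contained in `H C` for a compact set `C`. (In a locally compact totally
disconnected group every open subgroup contains a compact open one.) -/
def indSpace (H : Subgroup G) (ρ : Representation ℂ H V) : Submodule ℂ (G → V) where
  carrier := {f | (∀ (h : H) (g : G), f (h * g) = ρ h (f g)) ∧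
    (∃ K : Subgroup G, IsOpen (K : Set G) ∧ ∀ k ∈ K, ∀ g, f (g * k) = f g) ∧
    ∃ C : Set G, IsCompact C ∧ ∀ g, f g ≠ 0 → ∃ h : H, ∃ c ∈ C, g = h * c}
  add_mem' {a b} := by
    rintro ⟨ha, ⟨K, hK, haK⟩, C, hC, haC⟩ ⟨hb, ⟨L, hL, hbL⟩, D, hD, hbD⟩
    refine ⟨fun h g => by simp [ha, hb], ⟨K ⊓ L, hK.inter hL, fun k hk g => ?_⟩,
      C ∪ D, hC.union hD, fun g hg => ?_⟩
    · simp [haK k hk.1 g, hbL k hk.2 g]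
    · by_cases h0 : a g = 0
      · obtain ⟨h, c, hc, e⟩ := hbD g (fun h1 => hg (by simp [h0, h1]))
        exact ⟨h, c, Or.inr hc, e⟩
      · obtain ⟨h, c, hc, e⟩ := haC g h0
        exact ⟨h, c, Or.inl hc, e⟩
  zero_mem' := ⟨fun h g => by simp, ⟨⊤, isOpen_univ, fun _ _ _ => rfl⟩, ∅, isCompact_empty,
    fun g hg => (hg rfl).elim⟩
  smul_mem' z a := by
    rintro ⟨ha, ⟨K, hK, haK⟩, C, hC, haC⟩
    refine ⟨fun h g => by simp [ha], ⟨K, hK, fun k hk g => by simp [haK k hk g]⟩,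
      C, hC, fun g hg => haC g (fun h0 => hg (by simp [h0]))⟩

/-- The compactly induced representation `ind_H^G ρ`: `G` acts by right translation. -/
def ind (H : Subgroup G) (ρ : Representation ℂ H V) : Representation ℂ G (indSpace H ρ) where
  toFun g :=
    { toFun := fun f => ⟨fun x => f.1 (x * g), by
        obtain ⟨f, hf, ⟨K, hK, hfK⟩, C, hC, hfC⟩ := f
        refine ⟨fun h x => by simpa [mul_assoc] using hf h (x * g),
          ⟨K.comap (MulAut.conj g⁻¹).toMonoidHom, ?_, fun k hk x => ?_⟩,
          (fun c => c * g⁻¹) '' C, hC.image (continuous_mul_const _), fun x hx => ?_⟩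
        · refine hK.preimage (f := fun x => g⁻¹ * x * g⁻¹⁻¹) (by fun_prop)
        · have := hfK (g⁻¹ * k * g) (by simpa using hk) (x * g)
          simpa [mul_assoc] using this
        · obtain ⟨h, c, hc, e⟩ := hfC _ hx
          exact ⟨h, c * g⁻¹, ⟨c, hc, rfl⟩, by rw [← mul_assoc, ← e]; simp⟩⟩
      map_add' := fun _ _ => rfl
      map_smul' := fun _ _ => rfl }
  map_one' := by ext f x; simp
  map_mul' a b := by ext f x; simp [mul_assoc]

/-- Conjugation `h ↦ g h g⁻¹` on a normal subgroup, as an automorphism of topological groups. -/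
def conjEquiv (N : Subgroup G) [N.Normal] (g : G) : N ≃ₜ* N where
  toMulEquiv := MulAut.conjNormal g
  continuous_toFun := by
    refine Continuous.subtype_mk (f := fun x : N => g * x * g⁻¹) (by fun_prop) _
  continuous_invFun := by
    change Continuous (MulAut.conjNormal g).symm
    refine continuous_induced_rng.2 ?_
    have : (Subtype.val ∘ (MulAut.conjNormal g).symm : N → G) = fun x : N => g⁻¹ * x * g := by
      ext x; simp
    rw [this]
    fun_prop

lemma conjEquiv_apply (N : Subgroup G) [N.Normal] (g : G) (x : N) :
    (conjEquiv N g x : G) = g * x * g⁻¹ := MulAut.conjNormal_apply g x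

/-- The modulus `δ_N` of `G` acting by conjugation on a normal subgroup `N`:
`∫ f (g⁻¹ x g) dx = δ_N(g) ∫ f(x) dx` for a Haar measure `dx` on `N`. -/
def modulus (N : Subgroup G) [N.Normal] [LocallyCompactSpace N] : G →* ℝ≥0 :=
  letI : MeasurableSpace N := borel N
  haveI : BorelSpace N := ⟨rfl⟩
  { toFun := fun g => MeasureTheory.mulEquivHaarChar (conjEquiv N g)
    map_one' := by
      have : conjEquiv N (1 : G) = ContinuousMulEquiv.refl N := by
        ext x; simp [conjEquiv_apply]
      rw [this, MeasureTheory.mulEquivHaarChar_refl]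
    map_mul' := fun a b => by
      have : conjEquiv N (a * b) = (conjEquiv N b).trans (conjEquiv N a) := by
        ext x; simp [conjEquiv_apply, mul_assoc]
      rw [this, MeasureTheory.mulEquivHaarChar_trans, mul_comm] }

end General

/-! ### The groups `P_n`, `U_n` and `P_{n-1} U_n` -/

section Groups

variable (F : Type*) [Field F]

/-- The mirabolic subgroup `P_n` of `GL_n(F)`: matrices with last row `(0, …, 0, 1)`, that is
matrices `(g x; 0 1)` with `g ∈ GL_{n-1}(F)` and `x` a column. The group `P_1` is trivial. -/
def mirabolic (n : ℕ) : Subgroup (GL (Fin n) F) where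
  carrier := {g | ∀ i j : Fin n, (i : ℕ) + 1 = n → g i j = (1 : Matrix (Fin n) (Fin n) F) i j}
  mul_mem' {a b} ha hb i j hi := by
    have : ∀ l, a i l = (1 : Matrix (Fin n) (Fin n) F) i l := fun l => ha i l hi
    simp [Matrix.mul_apply, this, Matrix.one_apply, hb i j hi]
  one_mem' i j _ := by simp
  inv_mem' {a} ha i j hi := by
    have h1 : ∀ l, a i l = (1 : Matrix (Fin n) (Fin n) F) i l := fun l => ha i l hi
    have h2 : (a * a⁻¹) i j = (1 : Matrix (Fin n) (Fin n) F) i j := by simp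
    rw [← h2, Matrix.GeneralLinearGroup.coe_mul, Matrix.mul_apply]
    simp [h1, Matrix.one_apply]

variable {F}

lemma mirabolic_last {n : ℕ} (g : mirabolic F (n + 1)) (j : Fin (n + 1)) :
    (g : GL (Fin (n + 1)) F) (Fin.last n) j = if Fin.last n = j then 1 else 0 := by
  rw [← Matrix.one_apply]
  exact g.2 (Fin.last n) j (by simp)

/-- The projection `P_{n+1} → GL_n(F)`, `(g x; 0 1) ↦ g`. -/
def leviProj (n : ℕ) : mirabolic F (n + 1) →* GL (Fin n) F :=
  MonoidHom.toHomUnits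
    { toFun := fun g => (g : GL (Fin (n + 1)) F).val.submatrix Fin.castSucc Fin.castSucc
      map_one' := by
        ext i j
        simp [Matrix.one_apply]
      map_mul' := fun a b => by
        ext i j
        have h : Fin.last n ≠ j.castSucc := (Fin.castSucc_lt_last _).ne'
        simp [Matrix.mul_apply, Fin.sum_univ_castSucc, mirabolic_last, h] }

lemma leviProj_apply {n : ℕ} (g : mirabolic F (n + 1)) (i j : Fin n) :
    leviProj n g i j = (g : GL (Fin (n + 1)) F) i.castSucc j.castSucc := rfl

/-- The unipotent group `U_{n+1} = {(1 x; 0 1)}`, as a (normal) subgroup of `P_{n+1}`. -/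
def unip (F : Type*) [Field F] (n : ℕ) : Subgroup (mirabolic F (n + 1)) := (leviProj n).ker

instance (n : ℕ) : (unip F n).Normal := MonoidHom.normal_ker _

/-- The subgroup `P_n U_{n+1} = {(g x; 0 1) : g ∈ P_n}` of `P_{n+1}`. -/
def mirabolicUnip (F : Type*) [Field F] (n : ℕ) : Subgroup (mirabolic F (n + 1)) :=
  (mirabolic F n).comap (leviProj n)

/-- The projection `P_n U_{n+1} → P_n`. -/
def projMirabolic (n : ℕ) : mirabolicUnip F n →* mirabolic F n :=
  ((leviProj n).comp (mirabolicUnip F n).subtype).codRestrict _ fun y => y.2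

/-- For a character `θ` of `(F, +)`, the character of `P_{k+1} U_{k+2}` which is trivial on
`P_{k+1}` and maps `u ∈ U_{k+2}` to `θ(∑ u_{i,i+1}) = θ(u_{k+1,k+2})`. Both facts together mean
that `y = (g x; 0 1)`, with `g ∈ P_{k+1}`, is mapped to `θ` of the last coordinate of `x`. -/
def thetaChar (θ : AddChar F Circle) (k : ℕ) : mirabolicUnip F (k + 1) →* Circle where
  toFun y := θ ((y : mirabolic F (k + 2)).1 (Fin.last k).castSucc (Fin.last (k + 1)))
  map_one' := by
    have h : (Fin.last k).castSucc ≠ Fin.last (k + 1) := (Fin.castSucc_lt_last _).ne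
    simp [h]
  map_mul' a b := by
    have h : ∀ j : Fin (k + 1), (a : mirabolic F (k + 2)).1 (Fin.last k).castSucc j.castSucc =
        if Fin.last k = j then 1 else 0 := by
      intro j
      rw [← mirabolic_last (projMirabolic (k + 1) a) j]
      rfl
    rw [← AddChar.map_add_eq_mul]
    congr 1
    simp only [Subgroup.coe_mul, Matrix.GeneralLinearGroup.coe_mul, Matrix.mul_apply]
    rw [Fin.sum_univ_castSucc]
    simp only [h, mirabolic_last]
    simp [add_comm]

end Groups

/-! ### The functor `Φ⁺` -/

section PhiPlus

variable {F : Type*} [Field F] [ValuativeRel F] [TopologicalSpace F] [IsNonarchimedeanLocalField F]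

instance : T2Space F := by
  let := IsTopologicalAddGroup.rightUniformSpace F
  have := isUniformAddGroup_of_addCommGroup (G := F)
  infer_instance

lemma isClosed_mirabolic (n : ℕ) : IsClosed (mirabolic F n : Set (GL (Fin n) F)) := by
  have : (mirabolic F n : Set (GL (Fin n) F)) = ⋂ i : Fin n, ⋂ j : Fin n, ⋂ _ : (i : ℕ) + 1 = n,
      {g | g i j = (1 : Matrix (Fin n) (Fin n) F) i j} := by
    ext g
    simp only [Set.mem_iInter]
    rfl
  rw [this]
  refine isClosed_iInter fun i => isClosed_iInter fun j => isClosed_iInter fun _ => ?_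
  refine isClosed_eq ?_ continuous_const
  exact Units.continuous_val.matrix_elem i j

lemma isClosed_unip (n : ℕ) : IsClosed (unip F n : Set (mirabolic F (n + 1))) := by
  have : (unip F n : Set (mirabolic F (n + 1))) =
      (fun g : mirabolic F (n + 1) => (g : GL (Fin (n + 1)) F).val.submatrix Fin.castSucc Fin.castSucc) ⁻¹' {1} := by
    ext g
    simp only [unip, SetLike.mem_coe, MonoidHom.mem_ker, Units.ext_iff]
    rfl
  rw [this]
  refine isClosed_singleton.preimage ?_
  exact (Units.continuous_val.comp continuous_subtype_val).matrix_submatrix _ _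

instance (n : ℕ) : LocallyCompactSpace (unip F n) := by
  have : LocallyCompactSpace (Matrix (Fin (n + 1)) (Fin (n + 1)) F) :=
    inferInstanceAs (LocallyCompactSpace (Fin (n + 1) → Fin (n + 1) → F))
  have : LocallyCompactSpace (GL (Fin (n + 1)) F) :=
    inferInstanceAs (LocallyCompactSpace (Matrix (Fin (n + 1)) (Fin (n + 1)) F)ˣ)
  have : LocallyCompactSpace (mirabolic F (n + 1)) :=
    (isClosed_mirabolic (n + 1)).isClosedEmbedding_subtypeVal.locallyCompactSpace
  exact (isClosed_unip n).isClosedEmbedding_subtypeVal.locallyCompactSpace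

variable {V : Type*} [AddCommGroup V] [Module ℂ V]

/-- The representation `δ_{U_{k+2}}^{1/2} σ ⊗ θ` of `P_{k+1} U_{k+2}`, for a representation `σ` of
`P_{k+1}`. -/
def thetaTwist (θ : AddChar F Circle) {k : ℕ} (σ : Representation ℂ (mirabolic F (k + 1)) V) :
    Representation ℂ (mirabolicUnip F (k + 1)) V where
  toFun y := (((NNReal.sqrt (modulus (unip F (k + 1)) y) : ℝ) : ℂ) * (thetaChar θ k y : ℂ)) •
    σ (projMirabolic (k + 1) y)
  map_one' := by simp
  map_mul' a b := by
    simp only [map_mul, Subgroup.coe_mul, NNReal.sqrt_mul, NNReal.coe_mul, Complex.ofReal_mul,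
      Circle.coe_mul, smul_mul_smul_comm]
    congr 1
    ring

/-- The space of the representation `Φ⁺ σ`. -/
abbrev PhiPlusSpace (θ : AddChar F Circle) {k : ℕ}
    (σ : Representation ℂ (mirabolic F (k + 1)) V) :
    Submodule ℂ (mirabolic F (k + 2) → V) :=
  indSpace (mirabolicUnip F (k + 1)) (thetaTwist θ σ)

/-- `Φ⁺ σ = ind_{P_{k+1} U_{k+2}}^{P_{k+2}} (δ_{U_{k+2}}^{1/2} σ ⊗ θ)`, a representation of
`P_{k+2}`, for a representation `σ` of `P_{k+1}`. -/
def phiPlus (θ : AddChar F Circle) {k : ℕ} (σ : Representation ℂ (mirabolic F (k + 1)) V) :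
    Representation ℂ (mirabolic F (k + 2)) (PhiPlusSpace θ σ) :=
  ind (mirabolicUnip F (k + 1)) (thetaTwist θ σ)

end PhiPlus

/-! ### The groups `H` -/

section Levi

/-- The map `1, …, p-q+1, p-q+2, …, p ↦ 1, …, p-q+1, p-q+3, p-q+5, …, p+q-1` and
`p+1, …, p+q ↦ p-q+2, p-q+4, …, p+q`. -/
def wFun (p q i : ℕ) : ℕ :=
  if i ≤ p - q + 1 then i
  else if i ≤ p then 2 * i - (p - q + 1)
  else p - q + 2 * (i - p)

lemma wFun_mem {p q m i : ℕ} (hqp : q ≤ p) (hm : m = p + q ∨ m + 1 = p + q) (h1 : 1 ≤ i)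
    (hi : i ≤ m) : 1 ≤ wFun p q i ∧ wFun p q i ≤ m := by
  unfold wFun
  split_ifs <;> omega

lemma wFun_inj {p q i j : ℕ} (h : wFun p q i = wFun p q j) : i = j := by
  unfold wFun at h
  split_ifs at h <;> omega

/-- The permutation `wFun p q` of `{1, …, m}`, for `m = p + q` or `m = p + q - 1`, transported to
`Fin m = {0, …, m-1}`. -/
def wPerm (p q m : ℕ) (hqp : q ≤ p) (hm : m = p + q ∨ m + 1 = p + q) : Equiv.Perm (Fin m) :=
  Equiv.ofBijective
    (fun i => ⟨wFun p q (i + 1) - 1, by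
      have := wFun_mem hqp hm (Nat.le_add_left 1 i) i.2
      omega⟩)
    (Finite.injective_iff_bijective.1 fun i j h => by
      have hi := wFun_mem hqp hm (Nat.le_add_left 1 i) i.2
      have hj := wFun_mem hqp hm (Nat.le_add_left 1 j) j.2
      have h' : wFun p q (i + 1) - 1 = wFun p q (j + 1) - 1 := congrArg Fin.val h
      have := wFun_inj (p := p) (q := q) (i := (i : ℕ) + 1) (j := (j : ℕ) + 1) (by omega)
      exact Fin.ext (by omega))

variable (F : Type*) [Field F]

/-- The standard Levi subgroup of `GL_m(F)` of block diagonal matrices with blocks of sizes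
`a` and `m - a`. -/
def stdLevi (a m : ℕ) : Subgroup (GL (Fin m) F) where
  carrier := {g | ∀ i j : Fin m, ¬((i : ℕ) < a ↔ (j : ℕ) < a) → g i j = 0}
  mul_mem' {g h} hg hh i j hij := by
    rw [Matrix.GeneralLinearGroup.coe_mul, Matrix.mul_apply]
    refine Finset.sum_eq_zero fun l _ => ?_
    by_cases hl : ((i : ℕ) < a ↔ (l : ℕ) < a)
    · rw [hh l j (by tauto), mul_zero]
    · rw [hg i l hl, zero_mul]
  one_mem' i j hij := by
    have : i ≠ j := by rintro rfl; exact hij Iff.rfl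
    simp [this]
  inv_mem' {g} hg i j hij := by
    let e : Matrix (Fin m) (Fin m) F := Matrix.diagonal fun l => if (l : ℕ) < a then 1 else 0
    have hc : Commute g.val e := by
      ext i j
      simp only [e, Matrix.mul_diagonal, Matrix.diagonal_mul]
      by_cases h : ((i : ℕ) < a ↔ (j : ℕ) < a)
      · by_cases h' : (j : ℕ) < a <;> simp [h, h']
      · rw [show g.val i j = 0 from hg i j h]; simp
    have hc' : Commute (g⁻¹).val e := hc.units_inv_left
    have := congrFun (congrFun hc'.eq i) j
    simp only [e, Matrix.mul_diagonal, Matrix.diagonal_mul] at this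
    by_cases h : (i : ℕ) < a <;> by_cases h' : (j : ℕ) < a
    · exact (hij (by tauto)).elim
    · simpa [h, h'] using this.symm
    · simpa [h, h'] using this
    · exact (hij (by tauto)).elim

/-- The group `w M w⁻¹`, where `M` is the standard Levi subgroup of `GL_m(F)` with blocks of sizes
`p` and `m - p`, and `w` is the matrix of the permutation `wPerm p q m` (so that
`w e_j = e_{wPerm j}`). It is `H_{p,q}` if `m = p + q`, and `H_{p,q-1}` if `m = p + q - 1`
(in which case `w` is the restriction to `{1, …, p+q-1}` of the permutation for `m = p + q`). -/
def subgroupH (p q m : ℕ) (hqp : q ≤ p) (hm : m = p + q ∨ m + 1 = p + q) :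
    Subgroup (GL (Fin m) F) :=
  (stdLevi F p m).map
    (MulAut.conj ((Matrix.permMatrixHom (n := Fin m) (R := F)).toHomUnits
      (wPerm p q m hqp hm))).toMonoidHom

end Levi

end PAdic

end

noncomputable section

namespace PAdic

open Filter Topology Matrix

section General

variable {G : Type*} [Group G] [TopologicalSpace G] {V : Type*} [AddCommGroup V] [Module ℂ V]

lemma isLocallyConstant_of_eventually {X Y : Type*} [TopologicalSpace X] {f : X → Y}
    (h : ∀ x, ∀ᶠ y in 𝓝 x, f y = f x) : IsLocallyConstant f :=
  (IsLocallyConstant.iff_eventually_eq f).2 h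

lemma IsSmoothRep.eventually {π : Representation ℂ G V} (h : IsSmoothRep π) (v : V) :
    ∀ᶠ g in 𝓝 (1 : G), π g v = v := by
  obtain ⟨K, hK, hv⟩ := h v
  filter_upwards [hK.mem_nhds K.one_mem] with g hg using hv g hg

lemma IsSmoothRep.isLocallyConstant [IsTopologicalGroup G] {π : Representation ℂ G V}
    (h : IsSmoothRep π) (v : V) : IsLocallyConstant fun g => π g v := by
  refine isLocallyConstant_of_eventually fun g => ?_
  have h1 : Tendsto (fun x => g⁻¹ * x) (𝓝 g) (𝓝 1) := by
    have : Continuous fun x => g⁻¹ * x := by fun_prop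
    simpa using this.tendsto g
  filter_upwards [h1.eventually (h.eventually v)] with x hx
  have : x = g * (g⁻¹ * x) := by simp
  rw [this, map_mul, Module.End.mul_apply, hx]

lemma isSmoothRep_of_eventually [IsTopologicalGroup G] {π : Representation ℂ G V}
    (h : ∀ v, ∀ᶠ g in 𝓝 (1 : G), π g v = v) : IsSmoothRep π := fun v =>
  let K : Subgroup G :=
    { carrier := {g | π g v = v}
      one_mem' := by simp
      mul_mem' := fun {a b} ha hb => by
        rw [Set.mem_ofPred_eq] at *
        rw [map_mul, Module.End.mul_apply, hb, ha]
      inv_mem' := fun {a} ha => by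
        rw [Set.mem_ofPred_eq] at *
        nth_rewrite 1 [← ha]
        rw [← Module.End.mul_apply, ← map_mul]
        simp }
  ⟨K, K.isOpen_of_mem_nhds (h v), fun _ hk => hk⟩

/-- A positive character takes a value at most `1` at an element whose powers all lie in a
compact set. -/
lemma PosChar.le_one_of_pow_mem (χ : PosChar G) {C : Set G} (hC : IsCompact C) {x : G}
    (hx : ∀ n : ℕ, x ^ n ∈ C) : χ.toHom x ≤ 1 := by
  obtain ⟨M, hM⟩ := (hC.image χ.continuous_toHom).bddAbove
  by_contra! h
  obtain ⟨n, hn⟩ := pow_unbounded_of_one_lt M h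
  have := hM ⟨_, hx n, rfl⟩
  rw [map_pow] at this
  linarith

lemma PosChar.eq_one_of_zpow_mem (χ : PosChar G) {C : Set G} (hC : IsCompact C) {x : G}
    (hx : ∀ n : ℤ, x ^ n ∈ C) : χ.toHom x = 1 := by
  refine le_antisymm (χ.le_one_of_pow_mem hC fun n => by simpa using hx n) ?_
  have h := χ.le_one_of_pow_mem (x := x⁻¹) hC fun n => by simpa using hx (-n)
  have h1 : χ.toHom x * χ.toHom x⁻¹ = 1 := by rw [← map_mul]; simp
  nlinarith [χ.pos x]

variable [IsTopologicalGroup G]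

lemma isLocallyConstant_of_mem_indSpace {H : Subgroup G} {ρ : Representation ℂ H V} {f : G → V}
    (hf : f ∈ indSpace H ρ) : IsLocallyConstant f := by
  obtain ⟨-, ⟨K, hK, hfK⟩, -⟩ := hf
  refine isLocallyConstant_of_eventually fun g => ?_
  have h1 : Tendsto (fun x => g⁻¹ * x) (𝓝 g) (𝓝 1) := by
    have : Continuous fun x => g⁻¹ * x := by fun_prop
    simpa using this.tendsto g
  filter_upwards [h1.eventually (hK.mem_nhds K.one_mem)] with x hx
  simpa using hfK _ hx g

lemma mem_indSpace_of_isLocallyConstant {H : Subgroup G} {ρ : Representation ℂ H V} {f : G → V}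
    (hf : ∀ (h : H) (g : G), f (h * g) = ρ h (f g)) (hl : IsLocallyConstant f)
    {C : Set G} (hC : IsCompact C) (hfC : ∀ g, f g ≠ 0 → ∃ h : H, ∃ c ∈ C, g = h * c) :
    f ∈ indSpace H ρ := by
  refine ⟨hf, ?_, C, hC, hfC⟩
  let K : Subgroup G :=
    { carrier := {k | ∀ g, f (g * k) = f g}
      one_mem' := by simp
      mul_mem' := fun {a b} ha hb g => by rw [← mul_assoc, hb, ha]
      inv_mem' := fun {a} ha g => by rw [← ha]; simp }
  refine ⟨K, K.isOpen_of_mem_nhds (g := 1) ?_, fun k hk => hk⟩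
  have h1 : ∀ᶠ k in 𝓝 (1 : G), ∀ c ∈ C, f (c * k) = f c := by
    refine hC.eventually_forall_of_forall_eventually fun c _ => ?_
    have : Tendsto (fun z : G × G => z.2 * z.1) (𝓝 (1, c)) (𝓝 c) := by
      have : Continuous fun z : G × G => z.2 * z.1 := by fun_prop
      simpa using this.tendsto (1, c)
    have h2 := (IsLocallyConstant.iff_eventually_eq f).1 hl c
    filter_upwards [this.eventually h2, (continuous_snd.tendsto _).eventually h2] with z hz hz'
    rw [hz, hz']
  have h2 : ∀ᶠ k in 𝓝 (1 : G), ∀ c ∈ C, f (c * k⁻¹) = f c := by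
    have : Tendsto (fun k : G => k⁻¹) (𝓝 1) (𝓝 1) := by simpa using (continuous_inv (G := G)).tendsto 1
    exact this.eventually h1
  filter_upwards [h1, h2] with k hk hk' g
  by_cases h0 : f g = 0
  · by_contra hne
    obtain ⟨h, c, hc, e⟩ := hfC (g * k) (by rwa [h0] at hne)
    apply hne
    have e' : g = h * (c * k⁻¹) := by rw [← mul_assoc, ← e]; simp
    rw [e, hf, e', hf, hk' c hc]
  · obtain ⟨h, c, hc, rfl⟩ := hfC g h0
    rw [mul_assoc, hf, hf, hk c hc]

/-- The product of an element of a compactly induced representation with a locally constant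
function on the quotient. -/
lemma smul_mem_indSpace {H : Subgroup G} {ρ : Representation ℂ H V} {f : G → V}
    (hf : f ∈ indSpace H ρ) {ψ : G → ℂ} (hψ : IsLocallyConstant ψ)
    (hψH : ∀ (h : H) (g : G), ψ (h * g) = ψ g) : (fun g => ψ g • f g) ∈ indSpace H ρ := by
  have hl := isLocallyConstant_of_mem_indSpace hf
  obtain ⟨hf, -, C, hC, hfC⟩ := hf
  refine mem_indSpace_of_isLocallyConstant (fun h g => by simp [hf, hψH])
    (hψ.comp₂ hl (fun a b => a • b)) hC fun g hg => hfC g fun h0 => hg (by simp [h0])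

end General

section Average

variable {Γ : Type*} [Group Γ] [TopologicalSpace Γ] [IsTopologicalGroup Γ] [CompactSpace Γ]

/-- A clopen subset of a compact group has a volume: all translation invariant linear functionals
on the space of locally constant functions agree on it up to normalization. -/
lemma exists_average {S : Set Γ} (hS : IsClopen S) :
    ∃ m : ℝ, (S.Nonempty → 0 < m) ∧ ∀ μ : LocallyConstant Γ ℂ →ₗ[ℂ] ℂ,
      (∀ (γ : Γ) (φ ψ : LocallyConstant Γ ℂ), (∀ x, ψ x = φ (x * γ)) → μ ψ = μ φ) →
      μ (LocallyConstant.charFn ℂ hS) = m * μ 1 := by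
  classical
  let N : Subgroup Γ :=
    { carrier := {n | ∀ x, n * x ∈ S ↔ x ∈ S}
      one_mem' := by simp
      mul_mem' := fun {a b} ha hb x => by rw [mul_assoc, ha, hb]
      inv_mem' := fun {a} ha x => by rw [← ha]; simp }
  have hN : IsOpen (N : Set Γ) := by
    refine N.isOpen_of_mem_nhds (g := 1) ?_
    have h1 : ∀ᶠ n in 𝓝 (1 : Γ), ∀ x ∈ (Set.univ : Set Γ), (n * x ∈ S ↔ x ∈ S) := by
      refine isCompact_univ.eventually_forall_of_forall_eventually fun c _ => ?_
      have : Tendsto (fun z : Γ × Γ => z.1 * z.2) (𝓝 (1, c)) (𝓝 c) := by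
        have : Continuous fun z : Γ × Γ => z.1 * z.2 := by fun_prop
        simpa using this.tendsto (1, c)
      have h2 : ∀ᶠ y in 𝓝 c, (y ∈ S ↔ c ∈ S) := by
        by_cases hc : c ∈ S
        · filter_upwards [hS.isOpen.mem_nhds hc] with y hy; simp [hy, hc]
        · filter_upwards [hS.compl.isOpen.mem_nhds hc] with y hy; simp [hc]; exact hy
      filter_upwards [this.eventually h2, (continuous_snd.tendsto _).eventually h2] with z hz hz'
      rw [hz, hz']
    filter_upwards [h1] with n hn x using hn x trivial
  have : Finite (Γ ⧸ N) := N.quotient_finite_of_isOpen hN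
  have : DiscreteTopology (Γ ⧸ N) := QuotientGroup.discreteTopology hN
  cases nonempty_fintype (Γ ⧸ N)
  let D (c : Γ ⧸ N) : Set Γ := {x | ((x⁻¹ : Γ) : Γ ⧸ N) = c}
  have hD (c) : IsClopen (D c) := (isClopen_discrete {c}).preimage
    (f := fun x : Γ => ((x⁻¹ : Γ) : Γ ⧸ N)) (QuotientGroup.continuous_mk.comp continuous_inv)
  let a (c : Γ ⧸ N) : ℝ := if c.out⁻¹ ∈ S then 1 else 0
  have hmem (x : Γ) : x ∈ S ↔ ((x⁻¹ : Γ) : Γ ⧸ N).out⁻¹ ∈ S := by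
    obtain ⟨n, hn⟩ := QuotientGroup.mk_out_eq_mul N x⁻¹
    rw [hn, _root_.mul_inv_rev, inv_inv]
    exact ((N.inv_mem n.2) x).symm
  have hone : (1 : LocallyConstant Γ ℂ) = ∑ c, LocallyConstant.charFn ℂ (hD c) := by
    ext x
    rw [← LocallyConstant.coeFnAddMonoidHom_apply (∑ c, _), map_sum, Finset.sum_apply]
    simp [LocallyConstant.coe_charFn, Set.indicator_apply, D]
  have hchar : LocallyConstant.charFn ℂ hS = ∑ c, (a c : ℂ) • LocallyConstant.charFn ℂ (hD c) := by
    ext x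
    rw [← LocallyConstant.coeFnAddMonoidHom_apply (∑ c, _), map_sum, Finset.sum_apply]
    simp [LocallyConstant.coe_charFn, Set.indicator_apply, D]
    simp only [a, hmem x]
    split_ifs <;> simp
  have hcard : (0 : ℝ) < Fintype.card (Γ ⧸ N) := by exact_mod_cast Fintype.card_pos
  refine ⟨(∑ c, a c) / Fintype.card (Γ ⧸ N), fun ⟨x, hx⟩ => ?_, fun μ hμ => ?_⟩
  · refine div_pos (Finset.sum_pos' (fun c _ => ?_) ⟨_, Finset.mem_univ ((x⁻¹ : Γ) : Γ ⧸ N), ?_⟩) hcard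
    · simp only [a]; split_ifs <;> simp
    · simp [a, (hmem x).1 hx]
  · have hc (c) : μ (LocallyConstant.charFn ℂ (hD c)) = μ (LocallyConstant.charFn ℂ (hD ((1 : Γ) : Γ ⧸ N))) := by
      refine hμ c.out _ _ fun x => ?_
      have : x ∈ D c ↔ x * c.out ∈ D ((1 : Γ) : Γ ⧸ N) := by
        simp only [D, Set.mem_ofPred_eq]
        nth_rewrite 1 [← QuotientGroup.out_eq' c]
        rw [eq_comm, QuotientGroup.eq, eq_comm, QuotientGroup.eq]
        simp
      simp only [LocallyConstant.coe_charFn, Set.indicator_apply, this, Pi.one_apply]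
    rw [hone, hchar, map_sum, map_sum]
    simp only [map_smul, hc]
    rw [← Finset.sum_smul]
    simp
    field_simp

end Average

section Affine

variable {F : Type*} [Field F] {n : ℕ}

/-- The matrix `(A x; 0 1)`. -/
def affineMatrix (A : Matrix (Fin n) (Fin n) F) (x : Fin n → F) :
    Matrix (Fin (n + 1)) (Fin (n + 1)) F :=
  Matrix.of fun i j => Fin.lastCases (Fin.lastCases 1 (fun _ => 0) j)
    (fun i => Fin.lastCases (x i) (fun j => A i j) j) i

@[simp] lemma affineMatrix_castSucc_castSucc (A : Matrix (Fin n) (Fin n) F) (x : Fin n → F)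
    (i j : Fin n) : affineMatrix A x i.castSucc j.castSucc = A i j := by simp [affineMatrix]

@[simp] lemma affineMatrix_castSucc_last (A : Matrix (Fin n) (Fin n) F) (x : Fin n → F)
    (i : Fin n) : affineMatrix A x i.castSucc (Fin.last n) = x i := by simp [affineMatrix]

@[simp] lemma affineMatrix_last_castSucc (A : Matrix (Fin n) (Fin n) F) (x : Fin n → F)
    (j : Fin n) : affineMatrix A x (Fin.last n) j.castSucc = 0 := by simp [affineMatrix]

@[simp] lemma affineMatrix_last_last (A : Matrix (Fin n) (Fin n) F) (x : Fin n → F) :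
    affineMatrix A x (Fin.last n) (Fin.last n) = 1 := by simp [affineMatrix]

lemma affineMatrix_mul (A B : Matrix (Fin n) (Fin n) F) (x y : Fin n → F) :
    affineMatrix A x * affineMatrix B y = affineMatrix (A * B) (A *ᵥ y + x) := by
  ext i j
  rw [Matrix.mul_apply, Fin.sum_univ_castSucc]
  induction i using Fin.lastCases <;> induction j using Fin.lastCases <;>
    simp [Matrix.mul_apply, Matrix.mulVec, dotProduct]

lemma affineMatrix_one : affineMatrix (1 : Matrix (Fin n) (Fin n) F) 0 = 1 := by
  ext i j
  induction i using Fin.lastCases <;> induction j using Fin.lastCases <;>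
    simp [Matrix.one_apply, (Fin.castSucc_lt_last _).ne, (Fin.castSucc_lt_last _).ne']

/-- The element `(g x; 0 1)` of the mirabolic group. -/
def affine (g : GL (Fin n) F) (x : Fin n → F) : mirabolic F (n + 1) :=
  ⟨⟨affineMatrix g.val x, affineMatrix (g⁻¹).val (-((g⁻¹).val *ᵥ x)), by
      rw [affineMatrix_mul, ← affineMatrix_one]; simp [Matrix.mulVec_neg], by
      rw [affineMatrix_mul, ← affineMatrix_one]; simp⟩, by
    intro i j hi
    obtain rfl : i = Fin.last n := Fin.ext (by simpa using hi)
    change affineMatrix _ _ _ _ = _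
    rw [← affineMatrix_one]
    induction j using Fin.lastCases <;> simp⟩

lemma affine_apply (g : GL (Fin n) F) (x : Fin n → F) (i j : Fin (n + 1)) :
    (affine g x : GL (Fin (n + 1)) F) i j = affineMatrix g.val x i j := rfl

lemma affine_mul (g h : GL (Fin n) F) (x y : Fin n → F) :
    affine g x * affine h y = affine (g * h) (g.val *ᵥ y + x) := by
  apply Subtype.ext
  apply Units.ext
  exact affineMatrix_mul _ _ _ _

lemma affine_one : affine (1 : GL (Fin n) F) 0 = 1 := by
  apply Subtype.ext
  apply Units.ext
  exact affineMatrix_one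

@[simp] lemma leviProj_affine (g : GL (Fin n) F) (x : Fin n → F) : leviProj n (affine g x) = g := by
  apply Units.ext
  ext i j
  exact affineMatrix_castSucc_castSucc _ _ _ _

/-- The last column of an element of the mirabolic group, without its last entry. -/
def colVec (g : mirabolic F (n + 1)) : Fin n → F := fun i => g.1 i.castSucc (Fin.last n)

lemma eq_affine (g : mirabolic F (n + 1)) : g = affine (leviProj n g) (colVec g) := by
  apply Subtype.ext
  apply Units.ext
  ext i j
  change g.1 i j = affineMatrix _ _ i j
  induction i using Fin.lastCases with
  | last =>
    rw [mirabolic_last]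
    induction j using Fin.lastCases with
    | last => simp
    | cast j => simp [(Fin.castSucc_lt_last _).ne']
  | cast i =>
    induction j using Fin.lastCases with
    | last => simp [colVec]
    | cast j => rw [affineMatrix_castSucc_castSucc]; rfl

lemma mem_unip_iff (g : mirabolic F (n + 1)) : g ∈ unip F n ↔ leviProj n g = 1 := MonoidHom.mem_ker

lemma affine_mem_unip (x : Fin n → F) : affine 1 x ∈ unip F n := by
  rw [mem_unip_iff, leviProj_affine]

lemma eq_affine_of_mem_unip {u : mirabolic F (n + 1)} (hu : u ∈ unip F n) :
    u = affine 1 (colVec u) := by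
  conv_lhs => rw [eq_affine u, (mem_unip_iff u).1 hu]

lemma affine_one_mul (x y : Fin n → F) : affine (1 : GL (Fin n) F) x * affine 1 y = affine 1 (x + y) := by
  rw [affine_mul]; simp [add_comm]

lemma affine_one_zpow (x : Fin n → F) (m : ℤ) : affine (1 : GL (Fin n) F) x ^ m = affine 1 (m • x) := by
  let φ : Multiplicative (Fin n → F) →* mirabolic F (n + 1) :=
    { toFun := fun x => affine 1 x.toAdd
      map_one' := affine_one
      map_mul' := fun x y => (affine_one_mul _ _).symm }
  exact (map_zpow φ (Multiplicative.ofAdd x) m).symm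

lemma affine_conj (g : mirabolic F (n + 1)) (x : Fin n → F) :
    g * affine 1 x * g⁻¹ = affine 1 ((leviProj n g).val *ᵥ x) := by
  rw [mul_inv_eq_iff_eq_mul]
  nth_rewrite 1 3 [eq_affine g]
  rw [affine_mul, affine_mul]
  simp [add_comm]

end Affine

section Row

variable {F : Type*} [Field F] {k : ℕ}

/-- The last row of `g` for an element `(g x; 0 1)` of the mirabolic group. -/
def rowVec (g : mirabolic F (k + 2)) : Fin (k + 1) → F := fun j => leviProj (k + 1) g (Fin.last k) j

/-- The row vector `(0, …, 0, 1)`. -/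
def lastVec (F : Type*) [Field F] (k : ℕ) : Fin (k + 1) → F := Pi.single (Fin.last k) 1

lemma rowVec_mul (g h : mirabolic F (k + 2)) :
    rowVec (g * h) = rowVec g ᵥ* (leviProj (k + 1) h).val := by
  ext j
  simp only [rowVec, map_mul]
  rfl

lemma rowVec_one : rowVec (1 : mirabolic F (k + 2)) = lastVec F k := by
  ext j
  simp [rowVec, lastVec, Matrix.one_apply, Pi.single_apply, eq_comm]

lemma mem_mirabolicUnip_iff (y : mirabolic F (k + 2)) :
    y ∈ mirabolicUnip F (k + 1) ↔ rowVec y = lastVec F k := by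
  constructor
  · intro h
    ext j
    have := h (Fin.last k) j (by simp)
    simp only [rowVec, this, lastVec, Matrix.one_apply, Pi.single_apply, eq_comm]
  · intro h i j hi
    obtain rfl : i = Fin.last k := Fin.ext (by simpa using hi)
    have := congrFun h j
    simp only [rowVec] at this
    rw [this]
    simp only [lastVec, Matrix.one_apply, Pi.single_apply, eq_comm]

lemma rowVec_left_mul {y : mirabolic F (k + 2)} (hy : y ∈ mirabolicUnip F (k + 1))
    (g : mirabolic F (k + 2)) : rowVec (y * g) = rowVec g := by
  rw [rowVec_mul, (mem_mirabolicUnip_iff y).1 hy, ← rowVec_one, ← rowVec_mul, one_mul]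

lemma mul_inv_mem_of_rowVec_eq {g h : mirabolic F (k + 2)} (e : rowVec g = rowVec h) :
    g * h⁻¹ ∈ mirabolicUnip F (k + 1) := by
  rw [mem_mirabolicUnip_iff, rowVec_mul, e, ← rowVec_mul, mul_inv_cancel, rowVec_one]

lemma vecMul_leviProj_inv (r : Fin (k + 1) → F) (h : mirabolic F (k + 2)) :
    r ᵥ* (leviProj (k + 1) h).val ᵥ* (leviProj (k + 1) h⁻¹).val = r := by
  rw [Matrix.vecMul_vecMul, ← Units.val_mul, ← map_mul]
  simp

lemma rowVec_ne_zero (g : mirabolic F (k + 2)) : rowVec g ≠ 0 := by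
  intro h
  have h1 : rowVec (g * g⁻¹) = 0 := by rw [rowVec_mul, h, Matrix.zero_vecMul]
  rw [mul_inv_cancel, rowVec_one] at h1
  have := congrFun h1 (Fin.last k)
  simp [lastVec] at this

/-- The identity matrix with its last row replaced by `r`. -/
def rowMatrix (r : Fin (k + 1) → F) : Matrix (Fin (k + 1)) (Fin (k + 1)) F :=
  Matrix.updateRow 1 (Fin.last k) r

lemma vecMul_rowMatrix (r s : Fin (k + 1) → F) :
    r ᵥ* rowMatrix s = Function.update r (Fin.last k) 0 + r (Fin.last k) • s := by
  ext j
  rw [Matrix.vecMul, dotProduct, Fin.sum_univ_castSucc]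
  simp only [rowMatrix, Matrix.updateRow_self]
  simp only [Matrix.updateRow_ne (Fin.castSucc_lt_last _).ne, Matrix.one_apply]
  induction j using Fin.lastCases with
  | last => simp [(Fin.castSucc_lt_last _).ne]
  | cast j => simp [(Fin.castSucc_lt_last _).ne]

lemma rowMatrix_mul (r s : Fin (k + 1) → F) : rowMatrix r * rowMatrix s = rowMatrix (r ᵥ* rowMatrix s) := by
  ext i j
  have h : (rowMatrix r * rowMatrix s) i = (rowMatrix r i) ᵥ* rowMatrix s := rfl
  rw [h]
  by_cases hi : i = Fin.last k
  · subst hi; simp [rowMatrix]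
  · rw [rowMatrix, Matrix.updateRow_ne hi, rowMatrix, rowMatrix, Matrix.updateRow_ne hi]
    have : (1 : Matrix (Fin (k + 1)) (Fin (k + 1)) F) i = Pi.single i 1 := by
      ext j; simp [Matrix.one_apply, Pi.single_apply, eq_comm]
    rw [this, Matrix.single_one_vecMul, Matrix.row, Matrix.updateRow_ne hi, this]

lemma rowMatrix_lastVec : rowMatrix (lastVec F k) = 1 := by
  ext i j
  by_cases hi : i = Fin.last k
  · subst hi; simp [rowMatrix, lastVec, Matrix.one_apply, Pi.single_apply, eq_comm]
  · simp [rowMatrix, Matrix.updateRow_ne hi]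

/-- The last row of the inverse of the matrix `rowMatrix r`. -/
def rowInv (r : Fin (k + 1) → F) : Fin (k + 1) → F :=
  Function.update (fun j => -((r (Fin.last k))⁻¹ * r j)) (Fin.last k) (r (Fin.last k))⁻¹

lemma rowInv_vecMul {r : Fin (k + 1) → F} (hr : r (Fin.last k) ≠ 0) :
    rowInv r ᵥ* rowMatrix r = lastVec F k := by
  rw [vecMul_rowMatrix]
  ext j
  induction j using Fin.lastCases with
  | last => simp [rowInv, lastVec, hr]
  | cast j => simp [rowInv, lastVec, (Fin.castSucc_lt_last _).ne]

lemma vecMul_rowInv {r : Fin (k + 1) → F} (hr : r (Fin.last k) ≠ 0) :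
    r ᵥ* rowMatrix (rowInv r) = lastVec F k := by
  rw [vecMul_rowMatrix]
  ext j
  induction j using Fin.lastCases with
  | last => simp [rowInv, lastVec, hr]
  | cast j => simp [rowInv, lastVec, (Fin.castSucc_lt_last _).ne, hr]

/-- The invertible matrix which is the identity matrix with its last row replaced by `r`. -/
def rowUnit (r : Fin (k + 1) → F) (hr : r (Fin.last k) ≠ 0) : GL (Fin (k + 1)) F :=
  ⟨rowMatrix r, rowMatrix (rowInv r), by rw [rowMatrix_mul, vecMul_rowInv hr, rowMatrix_lastVec],
    by rw [rowMatrix_mul, rowInv_vecMul hr, rowMatrix_lastVec]⟩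

open Classical in
/-- A section of `rowVec` over the vectors with nonzero last entry. -/
def rowSec (r : Fin (k + 1) → F) : mirabolic F (k + 2) :=
  if hr : r (Fin.last k) ≠ 0 then affine (rowUnit r hr) 0 else 1

lemma rowSec_of_ne {r : Fin (k + 1) → F} (hr : r (Fin.last k) ≠ 0) :
    rowSec r = affine (rowUnit r hr) 0 := dif_pos hr

lemma leviProj_rowSec {r : Fin (k + 1) → F} (hr : r (Fin.last k) ≠ 0) :
    (leviProj (k + 1) (rowSec r)).val = rowMatrix r := by
  rw [rowSec_of_ne hr, leviProj_affine]; rfl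

lemma rowVec_rowSec {r : Fin (k + 1) → F} (hr : r (Fin.last k) ≠ 0) : rowVec (rowSec r) = r := by
  ext j
  change (leviProj (k + 1) (rowSec r)).val _ _ = _
  rw [leviProj_rowSec hr]
  simp [rowMatrix]

lemma rowSec_mul {r s : Fin (k + 1) → F} (hr : r (Fin.last k) ≠ 0) (hs : s (Fin.last k) ≠ 0) :
    rowSec r * rowSec s = rowSec (r ᵥ* (leviProj (k + 1) (rowSec s)).val) := by
  rw [leviProj_rowSec hs]
  have : (r ᵥ* rowMatrix s) (Fin.last k) ≠ 0 := by simp [vecMul_rowMatrix, hr, hs]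
  rw [rowSec_of_ne hr, rowSec_of_ne hs, rowSec_of_ne this, affine_mul]
  congr 1
  · exact Units.ext (rowMatrix_mul r s)
  · simp

lemma rowSec_lastVec : rowSec (lastVec F k) = 1 := by
  have h : lastVec F k (Fin.last k) ≠ 0 := by simp [lastVec]
  rw [rowSec_of_ne h, ← affine_one]
  congr 1
  exact Units.ext rowMatrix_lastVec

end Row

section TopologicalField

variable {F : Type*} [Field F] [TopologicalSpace F] {n : ℕ}

lemma continuous_affineMatrix : Continuous fun z : Matrix (Fin n) (Fin n) F × (Fin n → F) =>
    affineMatrix z.1 z.2 := by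
  refine continuous_matrix fun i j => ?_
  induction i using Fin.lastCases <;> induction j using Fin.lastCases <;> simp <;> fun_prop

lemma Continuous.affine [IsTopologicalRing F] {X : Type*} [TopologicalSpace X]
    {g : X → GL (Fin n) F} {x : X → Fin n → F} (hg : Continuous g) (hx : Continuous x) : Continuous fun t => affine (g t) (x t) := by
  have h1 : Continuous fun t => (g t).val := Units.continuous_val.comp hg
  have h2 : Continuous fun t => ((g t)⁻¹).val := Units.continuous_val.comp hg.inv
  refine Continuous.subtype_mk (Units.continuous_iff.2 ⟨?_, ?_⟩) _
  · exact continuous_affineMatrix.comp (h1.prodMk hx)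
  · exact continuous_affineMatrix.comp (h2.prodMk (h2.matrix_mulVec hx).neg)

lemma continuous_entry (i j : Fin n) : Continuous fun g : mirabolic F n => g.1 i j :=
  (Units.continuous_val.comp continuous_subtype_val).matrix_elem i j

lemma continuous_leviProj [IsTopologicalRing F] : Continuous (leviProj (F := F) n) := by
  have h : Continuous fun g : mirabolic F (n + 1) => (leviProj n g).val :=
    (Units.continuous_val.comp continuous_subtype_val).matrix_submatrix _ _
  refine Units.continuous_iff.2 ⟨h, ?_⟩
  have : (fun g : mirabolic F (n + 1) => ((leviProj n g)⁻¹).val) =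
      fun g => (leviProj n g⁻¹).val := by
    ext g : 1
    rw [map_inv]
  rw [this]
  exact h.comp continuous_inv

lemma continuous_rowVec : Continuous (rowVec (F := F) (k := n)) :=
  continuous_pi fun _ => continuous_entry _ _

lemma continuous_rowMatrix : Continuous (rowMatrix (F := F) (k := n)) :=
  continuous_const.matrix_updateRow _ continuous_id

lemma continuousOn_rowSec [IsTopologicalDivisionRing F] :
    ContinuousOn (rowSec (F := F) (k := n)) {r | r (Fin.last n) ≠ 0} := by
  rw [continuousOn_iff_continuous_domRestrict]
  have h : Set.domRestrict {r : Fin (n + 1) → F | r (Fin.last n) ≠ 0} rowSec =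
      fun r => affine (rowUnit r.1 r.2) 0 := by
    ext1 r
    exact rowSec_of_ne r.2
  rw [h]
  refine Continuous.affine (Units.continuous_iff.2 ⟨?_, ?_⟩) continuous_const
  · exact continuous_rowMatrix.comp continuous_subtype_val
  · refine continuous_rowMatrix.comp (f := fun r : {r : Fin (n + 1) → F | r (Fin.last n) ≠ 0} =>
      rowInv r.1) ?_
    have h1 : Continuous fun r : {r : Fin (n + 1) → F | r (Fin.last n) ≠ 0} => (r.1 (Fin.last n))⁻¹ :=
      Continuous.inv₀ ((continuous_apply _).comp continuous_subtype_val) fun r => r.2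
    refine Continuous.update (continuous_pi fun j => ?_) _ h1
    exact (h1.mul ((continuous_apply j).comp continuous_subtype_val)).neg

end TopologicalField

section LocalField

lemma valuation_mul_apply_le {F : Type*} [Field F] [ValuativeRel F] {m : ℕ}
    {a b : Matrix (Fin m) (Fin m) F} (ha : ∀ i j, ValuativeRel.valuation F (a i j) ≤ 1)
    (hb : ∀ i j, ValuativeRel.valuation F (b i j) ≤ 1) (i j) :
    ValuativeRel.valuation F ((a * b) i j) ≤ 1 := by
  rw [Matrix.mul_apply]
  refine Valuation.map_sum_le _ fun l _ => ?_
  rw [map_mul]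
  exact mul_le_one' (ha _ _) (hb _ _)

variable {F : Type*} [Field F] [ValuativeRel F] [TopologicalSpace F] [IsNonarchimedeanLocalField F]

local notation "ν" => ValuativeRel.valuation F

lemma isCompact_integers : IsCompact {x : F | ν x ≤ 1} :=
  IsNonarchimedeanLocalField.isCompact_closedBall F 1

lemma isClopen_integers : IsClopen {x : F | ν x ≤ 1} :=
  ⟨isCompact_integers.isClosed, (ν).isOpen_integer⟩

lemma isClopen_unitSphere : IsClopen {x : F | ν x = 1} := by
  have h : {x : F | ν x = 1} = {x : F | ν x ≤ 1} \ {x : F | ν x < 1} := by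
    ext x
    simp [← le_antisymm_iff]
  have h1 : IsClopen {x : F | ν x < 1} := by
    have := (ν).isClopen_ball 1
    simpa [Valuation.restrict_lt_one_iff] using this
  rw [h]
  exact isClopen_integers.diff h1

/-- A continuous unitary character of a non-archimedean local field is locally trivial. -/
lemma eventually_addChar_eq_one {θ : AddChar F Circle} (hθ : Continuous θ) :
    ∀ᶠ x in 𝓝 (0 : F), θ x = 1 := by
  have h1 : {x : F | ‖(θ x : ℂ) - 1‖ < 1 / 2} ∈ 𝓝 (0 : F) := by
    have : Continuous fun x : F => ‖(θ x : ℂ) - 1‖ := by fun_prop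
    exact (isOpen_lt this continuous_const).mem_nhds (by simp)
  obtain ⟨γ, hU⟩ := IsValuativeTopology.mem_nhds_zero_iff _ |>.1 h1
  let U : AddSubgroup F := (ν).ltAddSubgroup γ
  filter_upwards [IsValuativeTopology.mem_nhds_zero_iff _ |>.2 ⟨γ, subset_rfl⟩] with x (hx : x ∈ U)
  by_contra hne
  have hpos : 0 < ‖(θ x : ℂ) - 1‖ := by
    rw [norm_pos_iff, sub_ne_zero]
    exact fun h => hne (Circle.ext (by simpa using h))
  have key : ∀ m : ℕ, (3 / 2 : ℝ) ^ m * ‖(θ x : ℂ) - 1‖ ≤ ‖(θ ((2 ^ m) • x) : ℂ) - 1‖ := by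
    intro m
    induction m with
    | zero => simp
    | succ m ih =>
      have hy : ‖(θ ((2 ^ m) • x) : ℂ) - 1‖ < 1 / 2 := hU (U.nsmul_mem hx _)
      set z : ℂ := (θ ((2 ^ m) • x) : ℂ) with hz
      have h2 : (θ ((2 ^ (m + 1)) • x) : ℂ) = z ^ 2 := by
        rw [pow_succ, mul_comm, mul_nsmul', two_nsmul, AddChar.map_add_eq_mul, Circle.coe_mul, hz]
        ring
      have h3 : (3 / 2 : ℝ) ≤ ‖z + 1‖ := by
        have : ‖(2 : ℂ)‖ ≤ ‖z + 1‖ + ‖z - 1‖ := by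
          calc ‖(2 : ℂ)‖ = ‖(z + 1) - (z - 1)‖ := by ring_nf
            _ ≤ _ := norm_sub_le _ _
        rw [Complex.norm_two] at this
        linarith
      rw [h2, show z ^ 2 - 1 = (z + 1) * (z - 1) by ring, norm_mul, pow_succ']
      have := norm_nonneg (z - 1)
      nlinarith [pow_pos (show (0 : ℝ) < 3 / 2 by norm_num) m]
  obtain ⟨m, hm⟩ := pow_unbounded_of_one_lt (1 / ‖(θ x : ℂ) - 1‖) (show (1 : ℝ) < 3 / 2 by norm_num)
  rw [div_lt_iff₀ hpos] at hm
  have h2 : ‖(θ ((2 ^ m) • x) : ℂ) - 1‖ < 1 / 2 := hU (U.nsmul_mem hx _)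
  linarith [key m]

lemma isLocallyConstant_addChar {θ : AddChar F Circle} (hθ : Continuous θ) :
    IsLocallyConstant θ := by
  refine isLocallyConstant_of_eventually fun x => ?_
  have h : Tendsto (fun y => y - x) (𝓝 x) (𝓝 0) := by
    have : Continuous fun y : F => y - x := by fun_prop
    simpa using this.tendsto x
  filter_upwards [h.eventually (eventually_addChar_eq_one hθ)] with y hy
  rw [← sub_add_cancel y x, AddChar.map_add_eq_mul, hy, one_mul]

variable {n : ℕ}

/-- The integral points of the unipotent group. -/
def unipIntegers (F : Type*) [Field F] [ValuativeRel F] (n : ℕ) : Set (unip F n) :=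
  {u | ∀ i j, ValuativeRel.valuation F (u.1.1 i j) ≤ 1}

lemma isOpen_unipIntegers : IsOpen (unipIntegers F n) := by
  have : unipIntegers F n = ⋂ i, ⋂ j, {u | ν (u.1.1 i j) ≤ 1} := by
    ext; simp [unipIntegers]
  rw [this]
  refine isOpen_iInter_of_finite fun i => isOpen_iInter_of_finite fun j => ?_
  exact isClopen_integers.isOpen.preimage ((continuous_entry i j).comp continuous_subtype_val)

lemma isCompact_unipIntegers : IsCompact (unipIntegers F n) := by
  have h : IsCompact (Set.univ.pi fun _ : Fin n => {x : F | ν x ≤ 1}) :=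
    isCompact_univ_pi fun _ => isCompact_integers
  have hc : Continuous fun x : Fin n → F => (⟨affine 1 x, affine_mem_unip x⟩ : unip F n) :=
    (Continuous.affine continuous_const continuous_id).subtype_mk _
  refine (h.image hc).of_isClosed_subset ?_ fun u hu => ?_
  · have : unipIntegers F n = ⋂ i, ⋂ j, {u | ν (u.1.1 i j) ≤ 1} := by
      ext; simp [unipIntegers]
    rw [this]
    refine isClosed_iInter fun i => isClosed_iInter fun j => ?_
    exact isClopen_integers.isClosed.preimage ((continuous_entry i j).comp continuous_subtype_val)
  · exact ⟨colVec u.1, fun i _ => hu _ _, Subtype.ext (eq_affine_of_mem_unip u.2).symm⟩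

lemma modulus_eq_one_of_integral {g : mirabolic F (n + 1)} (hg : ∀ i j, ν (g.1 i j) ≤ 1)
    (hg' : ∀ i j, ν ((g⁻¹).1 i j) ≤ 1) : modulus (unip F n) g = 1 := by
  let _ : MeasurableSpace (unip F n) := borel _
  have _ : BorelSpace (unip F n) := ⟨rfl⟩
  change MeasureTheory.mulEquivHaarChar (conjEquiv (unip F n) g) = 1
  have hpre : conjEquiv (unip F n) g ⁻¹' unipIntegers F n = unipIntegers F n := by
    ext u
    constructor
    · intro hu i j
      have e : (u : mirabolic F (n + 1)) = g⁻¹ * (conjEquiv (unip F n) g u) * g := by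
        rw [conjEquiv_apply]; group
      rw [e]
      exact valuation_mul_apply_le (valuation_mul_apply_le hg' hu) hg i j
    · intro hu i j
      rw [conjEquiv_apply]
      exact valuation_mul_apply_le (valuation_mul_apply_le hg hu) hg' i j
  have h := MeasureTheory.mulEquivHaarChar_smul_preimage (X := unipIntegers F n)
    MeasureTheory.Measure.haar (conjEquiv (unip F n) g)
  rw [hpre] at h
  have h0 : MeasureTheory.Measure.haar (unipIntegers F n) ≠ 0 :=
    (isOpen_unipIntegers.measure_pos _ ⟨1, fun i j => by
      rcases eq_or_ne i j with rfl | hij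
      · simp
      · simp [hij]⟩).ne'
  have h1 : MeasureTheory.Measure.haar (unipIntegers F n) ≠ ⊤ := isCompact_unipIntegers.measure_ne_top
  rw [ENNReal.smul_def, smul_eq_mul] at h
  have h2 := (ENNReal.mul_eq_right h0 h1).1 h
  exact_mod_cast h2

lemma eventually_modulus_eq_one :
    ∀ᶠ g in 𝓝 (1 : mirabolic F (n + 1)), modulus (unip F n) g = 1 := by
  have h : ∀ᶠ g in 𝓝 (1 : mirabolic F (n + 1)), ∀ i j, ν (g.1 i j) ≤ 1 := by
    refine eventually_all.2 fun i => eventually_all.2 fun j => ?_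
    refine (continuous_entry i j).continuousAt.eventually (isClopen_integers.isOpen.mem_nhds ?_)
    rcases eq_or_ne i j with rfl | hij
    · simp
    · simp [hij]
  have h' : ∀ᶠ g in 𝓝 (1 : mirabolic F (n + 1)), ∀ i j, ν ((g⁻¹).1 i j) ≤ 1 := by
    have : Tendsto (fun g : mirabolic F (n + 1) => g⁻¹) (𝓝 1) (𝓝 1) := by
      simpa using (continuous_inv (G := mirabolic F (n + 1))).tendsto 1
    exact this.eventually h
  filter_upwards [h, h'] with g h1 h2 using modulus_eq_one_of_integral h1 h2

lemma modulus_eq_one_of_mem_unip {u : mirabolic F (n + 1)} (hu : u ∈ unip F n) :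
    modulus (unip F n) u = 1 := by
  let _ : MeasurableSpace (unip F n) := borel _
  have _ : BorelSpace (unip F n) := ⟨rfl⟩
  have : conjEquiv (unip F n) u = ContinuousMulEquiv.refl _ := by
    ext x : 2
    rw [conjEquiv_apply, eq_affine_of_mem_unip x.2, affine_conj, (mem_unip_iff u).1 hu]
    simpa using (eq_affine_of_mem_unip x.2).symm
  change MeasureTheory.mulEquivHaarChar _ = 1
  rw [this, MeasureTheory.mulEquivHaarChar_refl]

lemma modulus_pos (g : mirabolic F (n + 1)) : 0 < modulus (unip F n) g := by
  let _ : MeasurableSpace (unip F n) := borel _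
  have _ : BorelSpace (unip F n) := ⟨rfl⟩
  exact MeasureTheory.mulEquivHaarChar_pos _

variable {k : ℕ} {V : Type*} [AddCommGroup V] [Module ℂ V]

lemma isSmoothRep_thetaTwist {θ : AddChar F Circle} (hθ : Continuous θ)
    {σ : Representation ℂ (mirabolic F (k + 1)) V} (hσ : IsSmoothRep σ) :
    IsSmoothRep (thetaTwist θ σ) := by
  refine isSmoothRep_of_eventually fun x => ?_
  have h1 : ∀ᶠ y in 𝓝 (1 : mirabolicUnip F (k + 1)), modulus (unip F (k + 1)) y.1 = 1 :=
    (continuous_subtype_val.tendsto (1 : mirabolicUnip F (k + 1))).eventually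
      (p := fun g => modulus (unip F (k + 1)) g = 1) eventually_modulus_eq_one
  have h2 : ∀ᶠ y in 𝓝 (1 : mirabolicUnip F (k + 1)), thetaChar θ k y = 1 := by
    have hc : Continuous fun y : mirabolicUnip F (k + 1) =>
        y.1.1 (Fin.last k).castSucc (Fin.last (k + 1)) :=
      (continuous_entry _ _).comp continuous_subtype_val
    have := hc.tendsto 1
    have h0 : (1 : mirabolicUnip F (k + 1)).1.1 (Fin.last k).castSucc (Fin.last (k + 1)) = 0 := by
      simp [(Fin.castSucc_lt_last _).ne]
    rw [h0] at this
    exact this.eventually (eventually_addChar_eq_one hθ)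
  have h3 : ∀ᶠ y in 𝓝 (1 : mirabolicUnip F (k + 1)), σ (projMirabolic (k + 1) y) x = x := by
    have hc : Continuous (projMirabolic (F := F) (k + 1)) :=
      (continuous_leviProj.comp continuous_subtype_val).subtype_mk _
    have := hc.tendsto 1
    rw [map_one] at this
    exact this.eventually (hσ.eventually x)
  filter_upwards [h1, h2, h3] with y hy1 hy2 hy3
  change ((((NNReal.sqrt (modulus (unip F (k + 1)) y) : ℝ) : ℂ) * (thetaChar θ k y : ℂ)) •
    σ (projMirabolic (k + 1) y)) x = x
  simp [hy1, hy2, hy3]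

end LocalField

section Block

variable {F : Type*} [Field F] {k : ℕ}

/-- The subgroup of `GL_m(F)` of matrices which are block diagonal for the partition of the
coordinates given by a predicate. -/
def IsBlockGroup {m : ℕ} (c : ℕ → Prop) (H : Subgroup (GL (Fin m) F)) : Prop :=
  ∀ g, g ∈ H ↔ ∀ i j : Fin m, ¬(c i ↔ c j) → g i j = 0

lemma affine_single_mem {c : ℕ → Prop} {H : Subgroup (GL (Fin (k + 2)) F)}
    (hH : IsBlockGroup c H) (hc : c (k + 1)) {i : Fin (k + 1)} (hi : c i) (a : F) :
    (affine 1 (Pi.single i a) : mirabolic F (k + 2)).1 ∈ H := by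
  rw [hH]
  intro s t hst
  rw [affine_apply]
  induction s using Fin.lastCases with
  | last =>
    induction t using Fin.lastCases with
    | last => simp at hst
    | cast t => simp
  | cast s =>
    induction t using Fin.lastCases with
    | last =>
      have : s ≠ i := by rintro rfl; simp [hc, hi] at hst
      simp [this]
    | cast t =>
      have : s ≠ t := by rintro rfl; simp at hst
      simp [this]

end Block

section Support

variable {F : Type*} [Field F] [ValuativeRel F] [TopologicalSpace F] [IsNonarchimedeanLocalField F]
  {θ : AddChar F Circle} {k : ℕ} {V : Type*} [AddCommGroup V] [Module ℂ V]
  {σ : Representation ℂ (mirabolic F (k + 1)) V}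

/-- Multiplication of an element of `Φ⁺ σ` by a locally constant function of the last row. -/
def rowSmul (ψ : LocallyConstant (Fin (k + 1) → F) ℂ) (f : PhiPlusSpace θ σ) : PhiPlusSpace θ σ :=
  ⟨fun g => ψ (rowVec g) • f.1 g, smul_mem_indSpace f.2
    (ψ.isLocallyConstant.comp_continuous continuous_rowVec)
    fun h g => by rw [rowVec_left_mul h.2]⟩

lemma rowSmul_apply (ψ : LocallyConstant (Fin (k + 1) → F) ℂ) (f : PhiPlusSpace θ σ)
    (g : mirabolic F (k + 2)) : (rowSmul ψ f).1 g = ψ (rowVec g) • f.1 g := rfl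

lemma phiPlus_apply (f : PhiPlusSpace θ σ) (h g : mirabolic F (k + 2)) :
    (phiPlus θ σ h f).1 g = f.1 (g * h) := rfl

/-- The restriction of an element of `Φ⁺ σ` to the elements with last row in a clopen set,
extended by zero. -/
def rowCut {W : Set (Fin (k + 1) → F)} (hW : IsClopen W) (f : PhiPlusSpace θ σ) :
    PhiPlusSpace θ σ := rowSmul (LocallyConstant.charFn ℂ hW) f

open Classical in
lemma rowCut_apply {W : Set (Fin (k + 1) → F)} (hW : IsClopen W) (f : PhiPlusSpace θ σ)
    (g : mirabolic F (k + 2)) : (rowCut hW f).1 g = if rowVec g ∈ W then f.1 g else 0 := by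
  rw [rowCut, rowSmul_apply, LocallyConstant.coe_charFn, Set.indicator_apply]
  split_ifs <;> simp

/-- A linear form on `Φ⁺ σ` vanishes at `f` if it does so locally on the space of last rows. -/
lemma eq_zero_of_locally_eq_zero (l : Module.Dual ℂ (PhiPlusSpace θ σ)) (f : PhiPlusSpace θ σ)
    (hf : ∀ g, f.1 g ≠ 0 → ∃ W : Set (Fin (k + 1) → F), IsClopen W ∧ rowVec g ∈ W ∧
      ∀ W' (hW' : IsClopen W'), W' ⊆ W → l (rowCut hW' f) = 0) : l f = 0 := by
  have hl := isLocallyConstant_of_mem_indSpace f.2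
  obtain ⟨heq, -, C, hC, hfC⟩ := f.2
  have hC' : IsCompact (C ∩ {g | f.1 g ≠ 0}) := hC.inter_right (hl.isOpen_fiber 0).isClosed_compl
  obtain ⟨W, hW, hCW, hlW⟩ : ∃ W : Set (Fin (k + 1) → F), IsClopen W ∧
      (∀ g ∈ C ∩ {g | f.1 g ≠ 0}, rowVec g ∈ W) ∧
      ∀ W' (hW' : IsClopen W'), W' ⊆ W → l (rowCut hW' f) = 0 := by
    refine hC'.induction_on (p := fun S => ∃ W : Set (Fin (k + 1) → F), IsClopen W ∧
      (∀ g ∈ S, rowVec g ∈ W) ∧ ∀ W' (hW' : IsClopen W'), W' ⊆ W → l (rowCut hW' f) = 0)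
      ⟨∅, isClopen_empty, by simp, fun W' hW' h => ?_⟩ ?_ ?_ ?_
    · have : rowCut hW' f = 0 := by
        ext g
        rw [rowCut_apply, if_neg fun hg => h hg]
        rfl
      rw [this, map_zero]
    · rintro S T hST ⟨W, hW, hTW, h⟩
      exact ⟨W, hW, fun g hg => hTW g (hST hg), h⟩
    · rintro S T ⟨W, hW, hSW, h⟩ ⟨W₁, hW₁, hTW, h₁⟩
      refine ⟨W ∪ W₁, hW.union hW₁, fun g hg => hg.imp (hSW g) (hTW g), fun W' hW' hsub => ?_⟩
      have : rowCut hW' f = rowCut (hW'.inter hW) f + rowCut (hW'.diff hW) f := by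
        ext g
        change _ = (rowCut (hW'.inter hW) f).1 g + (rowCut (hW'.diff hW) f).1 g
        simp only [rowCut_apply, Set.mem_inter_iff, Set.mem_sdiff]
        by_cases h1 : rowVec g ∈ W' <;> by_cases h2 : rowVec g ∈ W <;> simp [h1, h2]
      rw [this, map_add, h _ _ Set.inter_subset_right, h₁, add_zero]
      exact fun r hr => (hsub hr.1).resolve_left hr.2
    · rintro g ⟨-, hg⟩
      obtain ⟨W, hW, hgW, h⟩ := hf g hg
      exact ⟨rowVec ⁻¹' W, mem_nhdsWithin_of_mem_nhds
        ((hW.isOpen.preimage continuous_rowVec).mem_nhds hgW), W, hW, fun _ h => h, h⟩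
  have : rowCut hW f = f := by
    ext g
    rw [rowCut_apply]
    by_cases hg : f.1 g = 0
    · simp [hg]
    · obtain ⟨h, c, hc, rfl⟩ := hfC g hg
      rw [if_pos]
      rw [rowVec_left_mul h.2]
      refine hCW c ⟨hc, fun h0 => hg ?_⟩
      rw [heq, h0, map_zero]
  rw [← this]
  exact hlW W hW subset_rfl

lemma phiPlus_affine_apply (x : Fin (k + 1) → F) (f : PhiPlusSpace θ σ)
    (g : mirabolic F (k + 2)) :
    (phiPlus θ σ (affine 1 x) f).1 g = (θ (rowVec g ⬝ᵥ x) : ℂ) • f.1 g := by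
  have hu : affine 1 ((leviProj (k + 1) g).val *ᵥ x) ∈ mirabolicUnip F (k + 1) := by
    change leviProj (k + 1) (affine 1 _) ∈ mirabolic F (k + 1)
    rw [leviProj_affine]
    exact one_mem _
  have h1 : g * affine 1 x = affine 1 ((leviProj (k + 1) g).val *ᵥ x) * g := by
    rw [← affine_conj]; group
  rw [phiPlus_apply, h1]
  have h2 := f.2.1 ⟨_, hu⟩ g
  rw [h2]
  change ((((NNReal.sqrt (modulus (unip F (k + 1)) (affine 1 _)) : ℝ) : ℂ) *
    (thetaChar θ k ⟨_, hu⟩ : ℂ)) • σ (projMirabolic (k + 1) ⟨_, hu⟩)) (f.1 g) = _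
  have h3 : projMirabolic (k + 1) ⟨_, hu⟩ = 1 := Subtype.ext (leviProj_affine _ _)
  have h4 : thetaChar θ k ⟨_, hu⟩ = θ (rowVec g ⬝ᵥ x) := by
    change θ (affineMatrix _ _ _ _) = _
    rw [affineMatrix_castSucc_last]
    rfl
  rw [modulus_eq_one_of_mem_unip (affine_mem_unip _), h3, h4]
  simp

variable {c : ℕ → Prop} {H : Subgroup (GL (Fin (k + 2)) F)}
  {χ : PosChar ↥(mirabolic F (k + 2) ⊓ H)}

/-- A linear form in `Hom_{P ∩ H}(Φ⁺ σ, χ)` is invariant under the unipotent elements of `H`. -/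
lemma apply_phiPlus_affine_single (hH : IsBlockGroup c H) (hc : c (k + 1)) {i : Fin (k + 1)}
    (hi : c i) (a : F) {l : Module.Dual ℂ (PhiPlusSpace θ σ)}
    (hl : l ∈ homChar (phiPlus θ σ) χ) (f : PhiPlusSpace θ σ) :
    l (phiPlus θ σ (affine 1 (Pi.single i a)) f) = l f := by
  let e (t : F) : ↥(mirabolic F (k + 2) ⊓ H) :=
    ⟨(affine 1 (Pi.single i (t * a)) : mirabolic F (k + 2)).1, (affine _ _).2,
      affine_single_mem hH hc hi _⟩
  have he : Continuous e := by
    refine Continuous.subtype_mk (continuous_subtype_val.comp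
      (Continuous.affine continuous_const ?_)) _
    exact (continuous_single i).comp (continuous_mul_const a)
  have h1 : χ.toHom (e 1) = 1 := by
    refine χ.eq_one_of_zpow_mem (isCompact_integers.image he) fun m => ⟨m, ?_, ?_⟩
    · exact intCast_mem (ValuativeRel.valuation F).integer m
    · apply Subtype.ext
      rw [SubgroupClass.coe_zpow]
      have := congrArg Subtype.val (affine_one_zpow (F := F) (Pi.single i (1 * a)) m)
      rw [SubgroupClass.coe_zpow] at this
      refine Eq.trans ?_ this.symm
      simp only [e]
      congr 2
      rw [← Pi.single_smul]
      simp
  have := hl (e 1) f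
  rw [h1, Complex.ofReal_one, one_mul] at this
  rw [← this]
  congr 2
  simp only [e, one_mul]
  rfl

/-- A linear form in `Hom_{P ∩ H}(Φ⁺ σ, χ)` is supported on the elements whose last row vanishes
in the block of the last coordinate. -/
lemma eq_zero_of_vanishing (hθ : Continuous θ) (hθ1 : ∃ x, θ x ≠ 1) (hH : IsBlockGroup c H)
    (hc : c (k + 1)) {l : Module.Dual ℂ (PhiPlusSpace θ σ)} (hl : l ∈ homChar (phiPlus θ σ) χ)
    (f : PhiPlusSpace θ σ) (hf : ∀ g, (∀ i : Fin (k + 1), c i → rowVec g i = 0) → f.1 g = 0) :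
    l f = 0 := by
  refine eq_zero_of_locally_eq_zero l f fun g hg => ?_
  obtain ⟨i, hi, hgi⟩ : ∃ i : Fin (k + 1), c i ∧ rowVec g i ≠ 0 := by
    by_contra! h
    exact hg (hf g h)
  obtain ⟨x, hx⟩ := hθ1
  set a : F := (rowVec g i)⁻¹ * x
  have hloc : IsLocallyConstant fun r : Fin (k + 1) → F => θ (r i * a) :=
    (isLocallyConstant_addChar hθ).comp_continuous (by fun_prop : Continuous fun r : Fin (k + 1) → F => r i * a)
  refine ⟨{r | θ (r i * a) ≠ 1}, (hloc.isClopen_fiber 1).compl, by simpa [a, hgi] using hx,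
    fun W hW hsub => ?_⟩
  let ψ : LocallyConstant (Fin (k + 1) → F) ℂ :=
    LocallyConstant.charFn ℂ hW * ⟨fun r => ((θ (r i * a) : ℂ) - 1)⁻¹, hloc.comp fun z : Circle => ((z : ℂ) - 1)⁻¹⟩
  have key : rowCut hW f = phiPlus θ σ (affine 1 (Pi.single i a)) (rowSmul ψ f) - rowSmul ψ f := by
    ext g
    change _ = (phiPlus θ σ (affine 1 (Pi.single i a)) (rowSmul ψ f)).1 g - (rowSmul ψ f).1 g
    rw [phiPlus_affine_apply, rowSmul_apply, rowCut, rowSmul_apply, smul_smul, ← sub_smul]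
    congr 1
    simp only [ψ, LocallyConstant.mul_apply, LocallyConstant.coe_mk, LocallyConstant.coe_charFn,
      dotProduct_single]
    by_cases hgW : rowVec g ∈ W
    · rw [Set.indicator_of_mem hgW]
      have h1 : (θ (rowVec g i * a) : ℂ) - 1 ≠ 0 := by
        rw [sub_ne_zero]
        exact fun h => hsub hgW (Circle.ext (by simpa using h))
      simp only [Pi.one_apply]
      field_simp
    · simp [Set.indicator_of_notMem hgW]
  rw [key, map_sub, apply_phiPlus_affine_single hH hc hi a hl, sub_self]

end Support

section UnitRows

lemma vecMul_vecMul_rowInv {F : Type*} [Field F] {k : ℕ} {s : Fin (k + 1) → F} (hs : s (Fin.last k) ≠ 0) (r : Fin (k + 1) → F) :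
    r ᵥ* rowMatrix s ᵥ* rowMatrix (rowInv s) = r := by
  rw [Matrix.vecMul_vecMul, rowMatrix_mul, vecMul_rowInv hs, rowMatrix_lastVec, Matrix.vecMul_one]

variable {F : Type*} [Field F] [ValuativeRel F] {k : ℕ}

local notation "ν" => ValuativeRel.valuation F

/-- Integral row vectors whose last entry is a unit. -/
def unitRows (F : Type*) [Field F] [ValuativeRel F] (k : ℕ) : Set (Fin (k + 1) → F) :=
  {r | (∀ i, ValuativeRel.valuation F (r i) ≤ 1) ∧ ValuativeRel.valuation F (r (Fin.last k)) = 1}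

lemma ne_zero_of_mem_unitRows {r : Fin (k + 1) → F} (hr : r ∈ unitRows F k) :
    r (Fin.last k) ≠ 0 := by
  intro h
  have := hr.2
  simp [h] at this

lemma lastVec_mem_unitRows : lastVec F k ∈ unitRows F k := by
  refine ⟨fun i => ?_, by simp [lastVec]⟩
  by_cases h : i = Fin.last k
  · subst h; simp [lastVec]
  · simp [lastVec, h]

lemma vecMul_mem_unitRows {r s : Fin (k + 1) → F} (hr : r ∈ unitRows F k) (hs : s ∈ unitRows F k) :
    r ᵥ* rowMatrix s ∈ unitRows F k := by
  rw [vecMul_rowMatrix]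
  refine ⟨fun i => ?_, by simp [hr.2, hs.2]⟩
  have h : ν (r (Fin.last k) * s i) ≤ 1 := by rw [map_mul, hr.2, one_mul]; exact hs.1 i
  by_cases hi : i = Fin.last k
  · subst hi; simpa using h
  · simpa [hi] using Valuation.map_add_le _ (hr.1 i) h

lemma rowInv_mem_unitRows {r : Fin (k + 1) → F} (hr : r ∈ unitRows F k) :
    rowInv r ∈ unitRows F k := by
  refine ⟨fun i => ?_, by simp [rowInv, hr.2]⟩
  by_cases hi : i = Fin.last k
  · subst hi; simp [rowInv, hr.2]
  · simpa [rowInv, hi, hr.2] using hr.1 i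

lemma vecMul_mem_unitRows_iff {r s : Fin (k + 1) → F} (hs : s ∈ unitRows F k) :
    r ᵥ* rowMatrix s ∈ unitRows F k ↔ r ∈ unitRows F k := by
  refine ⟨fun h => ?_, fun h => vecMul_mem_unitRows h hs⟩
  rw [← vecMul_vecMul_rowInv (ne_zero_of_mem_unitRows hs) r]
  exact vecMul_mem_unitRows h (rowInv_mem_unitRows hs)

lemma rowSec_inv {r : Fin (k + 1) → F} (hr : r ∈ unitRows F k) :
    (rowSec r)⁻¹ = rowSec (rowInv r) := by
  have h := ne_zero_of_mem_unitRows hr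
  have h' := ne_zero_of_mem_unitRows (rowInv_mem_unitRows hr)
  rw [inv_eq_iff_mul_eq_one, rowSec_mul h h', leviProj_rowSec h', vecMul_rowInv h, rowSec_lastVec]

lemma exists_eq_mul_rowSec {g : mirabolic F (k + 2)} (h : rowVec g ∈ unitRows F k) :
    ∃ y : mirabolicUnip F (k + 1), g = y * rowSec (rowVec g) :=
  ⟨⟨g * (rowSec (rowVec g))⁻¹, mul_inv_mem_of_rowVec_eq
    (rowVec_rowSec (ne_zero_of_mem_unitRows h)).symm⟩, by simp⟩

variable [TopologicalSpace F] [IsNonarchimedeanLocalField F]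

lemma isClopen_unitRows : IsClopen (unitRows F k) := by
  have : unitRows F k = (⋂ i, {r | ν (r i) ≤ 1}) ∩ {r | ν (r (Fin.last k)) = 1} := by
    ext; simp [unitRows]
  rw [this]
  refine IsClopen.inter (isClopen_iInter_of_finite fun i => ?_) ?_
  · exact isClopen_integers.preimage (continuous_apply i)
  · exact isClopen_unitSphere.preimage (continuous_apply _)

lemma isCompact_unitRows : IsCompact (unitRows F k) := by
  refine (isCompact_univ_pi fun _ : Fin (k + 1) =>
    isCompact_integers (F := F)).of_isClosed_subset isClopen_unitRows.isClosed ?_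
  exact fun r hr i _ => hr.1 i

lemma continuousOn_rowSec_unitRows : ContinuousOn (rowSec (F := F) (k := k)) (unitRows F k) :=
  continuousOn_rowSec.mono fun _ => ne_zero_of_mem_unitRows

end UnitRows

section BaseVector

variable {F : Type*} [Field F] [ValuativeRel F] [TopologicalSpace F] [IsNonarchimedeanLocalField F]
  {θ : AddChar F Circle} {k : ℕ} {V : Type*} [AddCommGroup V] [Module ℂ V]
  {σ : Representation ℂ (mirabolic F (k + 1)) V}

open Classical in
/-- The function on `P_{k+2}` with values in the space of `σ` which is supported on
`P_{k+1} U_{k+2} rowSec(unitRows)` and takes the value `x` on `rowSec(unitRows)`. -/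
def baseFun (θ : AddChar F Circle) (σ : Representation ℂ (mirabolic F (k + 1)) V) (x : V)
    (g : mirabolic F (k + 2)) : V :=
  if h : rowVec g ∈ unitRows F k then
    thetaTwist θ σ ⟨g * (rowSec (rowVec g))⁻¹, mul_inv_mem_of_rowVec_eq
      (rowVec_rowSec (ne_zero_of_mem_unitRows h)).symm⟩ x
  else 0

lemma baseFun_of_notMem (x : V) {g : mirabolic F (k + 2)} (h : rowVec g ∉ unitRows F k) :
    baseFun θ σ x g = 0 := dif_neg h

lemma baseFun_mul_rowSec (x : V) (y : mirabolicUnip F (k + 1)) {r : Fin (k + 1) → F}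
    (hr : r ∈ unitRows F k) : baseFun θ σ x (y * rowSec r) = thetaTwist θ σ y x := by
  have h : rowVec (y.1 * rowSec r) = r := by
    rw [rowVec_left_mul y.2, rowVec_rowSec (ne_zero_of_mem_unitRows hr)]
  rw [baseFun, dif_pos (by rwa [h])]
  congr 2
  apply Subtype.ext
  simp [h]

lemma baseFun_mul_rowSec_right (x : V) (g : mirabolic F (k + 2)) {s : Fin (k + 1) → F}
    (hs : s ∈ unitRows F k) : baseFun θ σ x (g * rowSec s) = baseFun θ σ x g := by
  have hs' := ne_zero_of_mem_unitRows hs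
  by_cases h : rowVec g ∈ unitRows F k
  · obtain ⟨y, hy⟩ := exists_eq_mul_rowSec h
    rw [hy, mul_assoc, rowSec_mul (ne_zero_of_mem_unitRows h) hs', leviProj_rowSec hs',
      baseFun_mul_rowSec x y (vecMul_mem_unitRows h hs), baseFun_mul_rowSec x y h]
  · rw [baseFun_of_notMem x h, baseFun_of_notMem]
    rwa [rowVec_mul, leviProj_rowSec hs', vecMul_mem_unitRows_iff hs]

lemma isLocallyConstant_baseFun (hθ : Continuous θ) (hσ : IsSmoothRep σ) (x : V) :
    IsLocallyConstant (baseFun θ σ x) := by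
  have hcl : IsClopen (rowVec (F := F) (k := k) ⁻¹' unitRows F k) :=
    isClopen_unitRows.preimage continuous_rowVec
  refine isLocallyConstant_of_eventually fun g => ?_
  by_cases hg : rowVec g ∈ unitRows F k
  · let m : (rowVec (F := F) (k := k) ⁻¹' unitRows F k : Set _) → mirabolicUnip F (k + 1) := fun g =>
      ⟨g * (rowSec (rowVec g.1))⁻¹, mul_inv_mem_of_rowVec_eq
        (rowVec_rowSec (ne_zero_of_mem_unitRows g.2)).symm⟩
    have hm : Continuous m := by
      refine Continuous.subtype_mk (continuous_subtype_val.mul (Continuous.inv ?_)) _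
      exact continuousOn_rowSec_unitRows.comp_continuous
        (continuous_rowVec.comp continuous_subtype_val) fun g => g.2
    have h1 := ((isSmoothRep_thetaTwist hθ hσ).isLocallyConstant x).comp_continuous hm
    have h2 := (IsLocallyConstant.iff_eventually_eq _).1 h1 ⟨g, hg⟩
    have h3 : 𝓝 g = map Subtype.val (𝓝 (⟨g, hg⟩ : (rowVec (F := F) (k := k) ⁻¹' unitRows F k : Set _))) :=
      (hcl.isOpen.isOpenEmbedding_subtypeVal.map_nhds_eq ⟨g, hg⟩).symm
    rw [h3, eventually_map]
    filter_upwards [h2] with z hz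
    rw [baseFun, dif_pos (show rowVec z.1 ∈ _ from z.2), baseFun, dif_pos hg]
    exact hz
  · filter_upwards [hcl.compl.isOpen.mem_nhds hg] with z hz
    rw [baseFun_of_notMem x hg, baseFun_of_notMem x hz]

lemma baseFun_mem (hθ : Continuous θ) (hσ : IsSmoothRep σ) (x : V) :
    baseFun θ σ x ∈ PhiPlusSpace θ σ := by
  refine mem_indSpace_of_isLocallyConstant (fun y g => ?_) (isLocallyConstant_baseFun hθ hσ x)
    (isCompact_unitRows.image_of_continuousOn continuousOn_rowSec_unitRows) fun g hg => ?_
  · by_cases h : rowVec g ∈ unitRows F k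
    · obtain ⟨z, hz⟩ := exists_eq_mul_rowSec h
      rw [hz, ← mul_assoc, ← Subgroup.coe_mul, baseFun_mul_rowSec x _ h, baseFun_mul_rowSec x _ h,
        map_mul, Module.End.mul_apply]
    · rw [baseFun_of_notMem x h, baseFun_of_notMem, map_zero]
      rwa [rowVec_left_mul y.2]
  · have h : rowVec g ∈ unitRows F k := by
      by_contra h
      exact hg (baseFun_of_notMem x h)
    obtain ⟨z, hz⟩ := exists_eq_mul_rowSec h
    exact ⟨z, _, ⟨_, h, rfl⟩, hz⟩

/-- The linear map which sends `x` to the element `baseFun x` of `Φ⁺ σ`. -/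
def baseVec (hθ : Continuous θ) (hσ : IsSmoothRep σ) : V →ₗ[ℂ] PhiPlusSpace θ σ where
  toFun x := ⟨baseFun θ σ x, baseFun_mem hθ hσ x⟩
  map_add' x y := by
    ext g
    change baseFun θ σ (x + y) g = baseFun θ σ x g + baseFun θ σ y g
    by_cases h : rowVec g ∈ unitRows F k
    · simp only [baseFun, dif_pos h, map_add]
    · simp only [baseFun_of_notMem _ h, add_zero]
  map_smul' a x := by
    ext g
    change baseFun θ σ (a • x) g = a • baseFun θ σ x g
    by_cases h : rowVec g ∈ unitRows F k
    · simp only [baseFun, dif_pos h, map_smul]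
    · simp only [baseFun_of_notMem _ h, smul_zero]

lemma baseVec_apply (hθ : Continuous θ) (hσ : IsSmoothRep σ) (x : V) (g : mirabolic F (k + 2)) :
    (baseVec hθ hσ x).1 g = baseFun θ σ x g := rfl

/-- The row vectors `r` such that `f` takes the same value at `h` and at
`rowSec(r h⁻¹) h`. -/
def stableRows (f : PhiPlusSpace θ σ) (h : mirabolic F (k + 2)) : Set (Fin (k + 1) → F) :=
  (fun r => r ᵥ* (leviProj (k + 1) h⁻¹).val) ⁻¹'
    (unitRows F k ∩ rowSec ⁻¹' {g | f.1 (g * h) = f.1 h})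

lemma continuous_vecMul (h : GL (Fin (k + 1)) F) :
    Continuous fun r : Fin (k + 1) → F => r ᵥ* h.val :=
  continuous_id.matrix_vecMul continuous_const

lemma isClopen_stableRows (f : PhiPlusSpace θ σ) (h : mirabolic F (k + 2)) :
    IsClopen (stableRows f h) := by
  have h1 : IsClopen {g : mirabolic F (k + 2) | f.1 (g * h) = f.1 h} :=
    ((isLocallyConstant_of_mem_indSpace f.2).comp_continuous
      (continuous_mul_const h)).isClopen_fiber (f.1 h)
  exact IsClopen.preimage ⟨continuousOn_rowSec_unitRows.preimage_isClosed_of_isClosed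
    isClopen_unitRows.isClosed h1.isClosed,
    continuousOn_rowSec_unitRows.isOpen_inter_preimage isClopen_unitRows.isOpen h1.isOpen⟩
    (continuous_vecMul _)

lemma rowVec_mem_stableRows (f : PhiPlusSpace θ σ) (h : mirabolic F (k + 2)) :
    rowVec h ∈ stableRows f h := by
  have : rowVec h ᵥ* (leviProj (k + 1) h⁻¹).val = lastVec F k := by
    rw [← rowVec_mul, mul_inv_cancel, rowVec_one]
  refine ⟨?_, ?_⟩
  · simp only [this, lastVec_mem_unitRows]
  · simp only [this, Set.mem_preimage, rowSec_lastVec, Set.mem_ofPred_eq, one_mul]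

/-- Near `h`, an element `f` of `Φ⁺ σ` is a translate of the base vector of `f h`. -/
lemma phiPlus_rowCut (hθ : Continuous θ) (hσ : IsSmoothRep σ) (f : PhiPlusSpace θ σ)
    (h : mirabolic F (k + 2)) {W : Set (Fin (k + 1) → F)} (hW : IsClopen W)
    (hsub : W ⊆ stableRows f h) :
    phiPlus θ σ h (rowCut hW f) =
      rowCut (hW.preimage (continuous_vecMul (leviProj (k + 1) h))) (baseVec hθ hσ (f.1 h)) := by
  ext g
  rw [phiPlus_apply, rowCut_apply, rowCut_apply, rowVec_mul]
  by_cases hg : rowVec g ᵥ* (leviProj (k + 1) h).val ∈ W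
  · rw [if_pos hg, if_pos (show rowVec g ∈ (fun r => r ᵥ* (leviProj (k + 1) h).val) ⁻¹' W from hg)]
    have h1 := hsub hg
    simp only [stableRows, Set.mem_preimage, Set.mem_inter_iff, vecMul_leviProj_inv,
      Set.mem_ofPred_eq] at h1
    obtain ⟨z, hz⟩ := exists_eq_mul_rowSec h1.1
    rw [baseVec_apply, hz, baseFun_mul_rowSec _ _ h1.1, ← h1.2, mul_assoc]
    exact f.2.1 z _
  · rw [if_neg hg, if_neg (show rowVec g ∉ (fun r => r ᵥ* (leviProj (k + 1) h).val) ⁻¹' W from hg)]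

end BaseVector

section BlockRows

variable {F : Type*} [Field F] {k : ℕ} {c : ℕ → Prop}

/-- Row vectors which vanish in the block given by the predicate `c`. -/
def blockRows (F : Type*) [Field F] (k : ℕ) (c : ℕ → Prop) : Set (Fin (k + 1) → F) :=
  {r | ∀ i : Fin (k + 1), c i → r i = 0}

open Classical in
/-- The projection to `blockRows`. -/
def blockProj (c : ℕ → Prop) (r : Fin (k + 1) → F) : Fin (k + 1) → F :=
  fun i => if c i then 0 else r i

lemma blockProj_mem (r : Fin (k + 1) → F) : blockProj c r ∈ blockRows F k c :=
  fun _ hi => if_pos hi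

lemma blockProj_of_mem {r : Fin (k + 1) → F} (hr : r ∈ blockRows F k c) : blockProj c r = r := by
  ext i
  by_cases hi : c i
  · simp [blockProj, hi, hr i hi]
  · simp [blockProj, hi]

lemma blockProj_vecMul (hc : ¬ c k) (r : Fin (k + 1) → F) {s : Fin (k + 1) → F}
    (hs : s ∈ blockRows F k c) :
    blockProj c (r ᵥ* rowMatrix s) = blockProj c r ᵥ* rowMatrix s := by
  ext i
  rw [vecMul_rowMatrix, vecMul_rowMatrix]
  by_cases hi : c i
  · have : i ≠ Fin.last k := by rintro rfl; exact hc (by simpa using hi)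
    simp [blockProj, hi, hs i hi, this, hc]
  · by_cases h : i = Fin.last k
    · subst h; simp [blockProj, hc]
    · simp [blockProj, hi, hc, h]

lemma vecMul_mem_blockRows {r s : Fin (k + 1) → F} (hr : r ∈ blockRows F k c)
    (hs : s ∈ blockRows F k c) (hc : ¬ c k) : r ᵥ* rowMatrix s ∈ blockRows F k c := by
  rw [← blockProj_of_mem hr, ← blockProj_vecMul hc _ hs]
  exact blockProj_mem _

lemma lastVec_mem_blockRows (hc : ¬ c k) : lastVec F k ∈ blockRows F k c := by
  intro i hi
  have : i ≠ Fin.last k := by rintro rfl; exact hc (by simpa using hi)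
  simp [lastVec, this]

lemma rowInv_mem_blockRows {r : Fin (k + 1) → F} (hr : r ∈ blockRows F k c) (hc : ¬ c k) :
    rowInv r ∈ blockRows F k c := by
  intro i hi
  have : i ≠ Fin.last k := by rintro rfl; exact hc (by simpa using hi)
  simp [rowInv, this, hr i hi]

lemma affine_mem_blockGroup {H : Subgroup (GL (Fin (k + 2)) F)} (hH : IsBlockGroup c H)
    {g : GL (Fin (k + 1)) F} (hg : ∀ i j : Fin (k + 1), ¬(c i ↔ c j) → g i j = 0) :
    (affine g 0 : mirabolic F (k + 2)).1 ∈ H := by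
  rw [hH]
  intro i j hij
  rw [affine_apply]
  induction i using Fin.lastCases with
  | last =>
    induction j using Fin.lastCases with
    | last => simp at hij
    | cast j => simp
  | cast i =>
    induction j using Fin.lastCases with
    | last => simp
    | cast j => simpa using hg i j (by simpa using hij)

lemma rowUnit_block (hc : ¬ c k) {r : Fin (k + 1) → F} (hr : r ∈ blockRows F k c)
    (h : r (Fin.last k) ≠ 0) (i j : Fin (k + 1)) (hij : ¬(c i ↔ c j)) : rowUnit r h i j = 0 := by
  change rowMatrix r i j = 0
  by_cases hi : i = Fin.last k
  · subst hi
    simp only [rowMatrix, Matrix.updateRow_self]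
    refine hr j ?_
    simp only [Fin.val_last] at hij
    tauto
  · rw [rowMatrix, Matrix.updateRow_ne hi, Matrix.one_apply_ne]
    rintro rfl
    exact hij Iff.rfl

lemma rowSec_mem_blockGroup {H : Subgroup (GL (Fin (k + 2)) F)} (hH : IsBlockGroup c H)
    (hc : ¬ c k) {r : Fin (k + 1) → F} (hr : r ∈ blockRows F k c) (h : r (Fin.last k) ≠ 0) :
    (rowSec r).1 ∈ H := by
  rw [rowSec_of_ne h]
  exact affine_mem_blockGroup hH (rowUnit_block hc hr h)

/-- A block group acts transitively on the nonzero rows which vanish in the other block. -/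
lemma exists_rowVec_eq {H : Subgroup (GL (Fin (k + 2)) F)} (hH : IsBlockGroup c H)
    (hc : ¬ c k) {r : Fin (k + 1) → F} (hr : r ∈ blockRows F k c) (hr0 : r ≠ 0) :
    ∃ h : mirabolic F (k + 2), h.1 ∈ H ∧ rowVec h = r := by
  obtain ⟨b, hb⟩ := Function.ne_iff.1 hr0
  have hcb : ¬ c b := fun h => hb (hr b h)
  let s : Equiv.Perm (Fin (k + 1)) := Equiv.swap b (Fin.last k)
  have hs (i : Fin (k + 1)) : c (s i) ↔ c i := by
    simp only [s, Equiv.swap_apply_def]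
    split_ifs with h1 h2
    · subst h1; simp [hc, hcb]
    · subst h2; simp [hc, hcb]
    · rfl
  let w : GL (Fin (k + 1)) F :=
    ⟨s.toPEquiv.toMatrix, s.symm.toPEquiv.toMatrix, by
      rw [← PEquiv.toMatrix_trans, ← Equiv.toPEquiv_trans]; simp, by
      rw [← PEquiv.toMatrix_trans, ← Equiv.toPEquiv_trans]; simp⟩
  have hw (i j : Fin (k + 1)) (hij : ¬(c i ↔ c j)) : w i j = 0 := by
    change s.toPEquiv.toMatrix i j = 0
    rw [PEquiv.toMatrix_apply, if_neg]
    simp only [Equiv.toPEquiv_apply, Option.mem_some_iff]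
    rintro rfl
    exact hij (hs i).symm
  have h1 : (r ∘ s) (Fin.last k) ≠ 0 := by simpa [s] using hb
  have h2 : r ∘ s ∈ blockRows F k c := fun i hi => hr _ ((hs i).2 hi)
  refine ⟨rowSec (r ∘ s) * affine w 0, H.mul_mem (rowSec_mem_blockGroup hH hc h2 h1)
    (affine_mem_blockGroup hH hw), ?_⟩
  rw [rowVec_mul, rowVec_rowSec h1, leviProj_affine]
  change (r ∘ s) ᵥ* s.toPEquiv.toMatrix = r
  ext j
  rw [PEquiv.vecMul_toMatrix_toPEquiv]
  simp

lemma continuous_blockProj [TopologicalSpace F] : Continuous (blockProj (F := F) (k := k) c) := by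
  refine continuous_pi fun i => ?_
  by_cases hi : c i
  · simpa [blockProj, hi] using continuous_const
  · simpa [blockProj, hi] using continuous_apply i

end BlockRows

section Gamma

variable {F : Type*} [Field F] [ValuativeRel F] {k : ℕ} {c : ℕ → Prop}

/-- The group of integral elements `rowSec r` in a block group. -/
def integralRowGroup (F : Type*) [Field F] [ValuativeRel F] {k : ℕ} {c : ℕ → Prop} (hc : ¬ c k) :
    Subgroup (mirabolic F (k + 2)) where
  carrier := rowSec '' (unitRows F k ∩ blockRows F k c)
  one_mem' := ⟨_, ⟨lastVec_mem_unitRows, lastVec_mem_blockRows hc⟩, rowSec_lastVec⟩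
  mul_mem' := by
    rintro _ _ ⟨r, hr, rfl⟩ ⟨s, hs, rfl⟩
    have h := ne_zero_of_mem_unitRows hs.1
    rw [rowSec_mul (ne_zero_of_mem_unitRows hr.1) h, leviProj_rowSec h]
    exact ⟨_, ⟨vecMul_mem_unitRows hr.1 hs.1, vecMul_mem_blockRows hr.2 hs.2 hc⟩, rfl⟩
  inv_mem' := by
    rintro _ ⟨r, hr, rfl⟩
    rw [rowSec_inv hr.1]
    exact ⟨_, ⟨rowInv_mem_unitRows hr.1, rowInv_mem_blockRows hr.2 hc⟩, rfl⟩

lemma blockProj_mem_unitRows (hc : ¬ c k) {r : Fin (k + 1) → F} (hr : r ∈ unitRows F k) :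
    blockProj c r ∈ unitRows F k := by
  refine ⟨fun i => ?_, by simpa [blockProj, hc] using hr.2⟩
  by_cases hi : c i
  · simp [blockProj, hi]
  · simpa [blockProj, hi] using hr.1 i

open Classical in
/-- The retraction of the space of rows to the group `integralRowGroup`. -/
def rowRetract (F : Type*) [Field F] [ValuativeRel F] {k : ℕ} {c : ℕ → Prop} (hc : ¬ c k)
    (r : Fin (k + 1) → F) : integralRowGroup F hc :=
  if h : blockProj c r ∈ unitRows F k then ⟨rowSec (blockProj c r), _, ⟨h, blockProj_mem r⟩, rfl⟩
  else 1

lemma coe_rowRetract (hc : ¬ c k) {r : Fin (k + 1) → F} (hr : r ∈ unitRows F k) :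
    (rowRetract F hc r : mirabolic F (k + 2)) = rowSec (blockProj c r) := by
  simp [rowRetract, blockProj_mem_unitRows hc hr]

lemma rowRetract_vecMul (hc : ¬ c k) {r s : Fin (k + 1) → F} (hr : r ∈ unitRows F k)
    (hs : s ∈ unitRows F k ∩ blockRows F k c) :
    rowRetract F hc (r ᵥ* rowMatrix s) = rowRetract F hc r * ⟨rowSec s, s, hs, rfl⟩ := by
  apply Subtype.ext
  have h := ne_zero_of_mem_unitRows hs.1
  rw [coe_rowRetract hc (vecMul_mem_unitRows hr hs.1), Subgroup.coe_mul, coe_rowRetract hc hr,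
    rowSec_mul (ne_zero_of_mem_unitRows (blockProj_mem_unitRows hc hr)) h, leviProj_rowSec h,
    blockProj_vecMul hc _ hs.2]

variable [TopologicalSpace F] [IsNonarchimedeanLocalField F]

lemma isClosed_blockRows : IsClosed (blockRows F k c) := by
  have : blockRows F k c = ⋂ i : Fin (k + 1), ⋂ _ : c i, {r | r i = 0} := by
    ext; simp [blockRows]
  rw [this]
  exact isClosed_iInter fun i => isClosed_iInter fun _ =>
    isClosed_eq (continuous_apply i) continuous_const

lemma isCompact_integralRowGroup (hc : ¬ c k) :
    IsCompact (integralRowGroup F hc : Set (mirabolic F (k + 2))) :=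
  (isCompact_unitRows.inter_right isClosed_blockRows).image_of_continuousOn
    (continuousOn_rowSec_unitRows.mono Set.inter_subset_left)

instance (hc : ¬ c k) : CompactSpace (integralRowGroup F hc) :=
  isCompact_iff_compactSpace.1 (isCompact_integralRowGroup hc)

lemma continuous_rowRetract (hc : ¬ c k) : Continuous (rowRetract F hc) := by
  classical
  have hE : IsClopen (blockProj c ⁻¹' unitRows F k) := isClopen_unitRows.preimage continuous_blockProj
  refine continuous_induced_rng.2 ?_
  have : Subtype.val ∘ rowRetract F hc =
      (blockProj c ⁻¹' unitRows F k).piecewise (fun r => rowSec (blockProj c r)) fun _ => 1 := by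
    ext1 r
    by_cases h : blockProj c r ∈ unitRows F k
    · rw [Set.piecewise_eq_of_mem _ _ _ (show r ∈ blockProj c ⁻¹' unitRows F k from h)]
      simp [rowRetract, h]
    · rw [Set.piecewise_eq_of_notMem _ _ _ (show r ∉ blockProj c ⁻¹' unitRows F k from h)]
      simp [rowRetract, h]
  rw [this]
  refine continuous_piecewise (by simp [hE.frontier_eq]) ?_ continuousOn_const
  rw [hE.isClosed.closure_eq]
  exact continuousOn_rowSec_unitRows.comp continuous_blockProj.continuousOn fun _ h => h

end Gamma

section Volume

variable {F : Type*} [Field F] [ValuativeRel F] [TopologicalSpace F] [IsNonarchimedeanLocalField F]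
  {θ : AddChar F Circle} {k : ℕ} {V : Type*} [AddCommGroup V] [Module ℂ V]
  {σ : Representation ℂ (mirabolic F (k + 1)) V}
  {c : ℕ → Prop} {H : Subgroup (GL (Fin (k + 2)) F)}
  {χ : PosChar ↥(mirabolic F (k + 2) ⊓ H)}

lemma rowSmul_add (φ ψ : LocallyConstant (Fin (k + 1) → F) ℂ) (f : PhiPlusSpace θ σ) :
    rowSmul (φ + ψ) f = rowSmul φ f + rowSmul ψ f :=
  Subtype.ext (funext fun g => add_smul (φ (rowVec g)) (ψ (rowVec g)) (f.1 g))

lemma smul_rowSmul (a : ℂ) (φ : LocallyConstant (Fin (k + 1) → F) ℂ) (f : PhiPlusSpace θ σ) :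
    rowSmul (a • φ) f = a • rowSmul φ f :=
  Subtype.ext (funext fun g => mul_smul a (φ (rowVec g)) (f.1 g))

lemma one_rowSmul (f : PhiPlusSpace θ σ) : rowSmul 1 f = f :=
  Subtype.ext (funext fun g => one_smul ℂ (f.1 g))

/-- The linear functional on locally constant functions on `integralRowGroup` which is given by
a linear form on `Φ⁺ σ` and a base vector. -/
def rowFunctional (hc : ¬ c k) (l : Module.Dual ℂ (PhiPlusSpace θ σ)) (f : PhiPlusSpace θ σ) :
    LocallyConstant (integralRowGroup F hc) ℂ →ₗ[ℂ] ℂ where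
  toFun φ := l (rowSmul (φ.comap ⟨_, continuous_rowRetract hc⟩) f)
  map_add' φ ψ := (congrArg l (rowSmul_add (φ.comap ⟨_, continuous_rowRetract hc⟩)
    (ψ.comap ⟨_, continuous_rowRetract hc⟩) f)).trans (LinearMap.map_add l _ _)
  map_smul' a φ := (congrArg l (smul_rowSmul a (φ.comap ⟨_, continuous_rowRetract hc⟩) f)).trans
    (LinearMap.map_smul l _ _)

lemma rowFunctional_apply (hc : ¬ c k) (l : Module.Dual ℂ (PhiPlusSpace θ σ))
    (f : PhiPlusSpace θ σ) (φ : LocallyConstant (integralRowGroup F hc) ℂ) :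
    rowFunctional hc l f φ = l (rowSmul (φ.comap ⟨_, continuous_rowRetract hc⟩) f) := rfl

lemma PosChar.integralRowGroup_eq_one (hH : IsBlockGroup c H) (hc : ¬ c k)
    {g : mirabolic F (k + 2)} (hg : g ∈ integralRowGroup F hc) (hgH : g.1 ∈ H) :
    χ.toHom ⟨g.1, g.2, hgH⟩ = 1 := by
  have hmem : ∀ g : integralRowGroup F hc, g.1.1 ∈ H := by
    rintro ⟨_, r, hr, rfl⟩
    exact rowSec_mem_blockGroup hH hc hr.2 (ne_zero_of_mem_unitRows hr.1)
  let e (g : integralRowGroup F hc) : ↥(mirabolic F (k + 2) ⊓ H) := ⟨g.1.1, g.1.2, hmem g⟩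
  have he : Continuous e :=
    (continuous_subtype_val.comp continuous_subtype_val).subtype_mk _
  exact χ.eq_one_of_zpow_mem (isCompact_range he) fun m =>
    ⟨⟨g, hg⟩ ^ m, Subtype.ext (by simp [e])⟩

lemma rowFunctional_translate (hθ : Continuous θ) (hσ : IsSmoothRep σ) (hH : IsBlockGroup c H)
    (hc : ¬ c k) {l : Module.Dual ℂ (PhiPlusSpace θ σ)} (hl : l ∈ homChar (phiPlus θ σ) χ) (x : V)
    (γ : integralRowGroup F hc) (φ ψ : LocallyConstant (integralRowGroup F hc) ℂ)
    (h : ∀ y, ψ y = φ (y * γ)) :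
    rowFunctional hc l (baseVec hθ hσ x) ψ = rowFunctional hc l (baseVec hθ hσ x) φ := by
  obtain ⟨_, s, hs, rfl⟩ := γ
  have hs0 := ne_zero_of_mem_unitRows hs.1
  have hsH := rowSec_mem_blockGroup hH hc hs.2 hs0
  have h1 : rowSmul (ψ.comap ⟨_, continuous_rowRetract hc⟩) (baseVec hθ hσ x) =
      phiPlus θ σ (rowSec s) (rowSmul (φ.comap ⟨_, continuous_rowRetract hc⟩) (baseVec hθ hσ x)) := by
    ext g
    rw [phiPlus_apply, rowSmul_apply, rowSmul_apply, baseVec_apply, baseVec_apply,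
      baseFun_mul_rowSec_right x g hs.1, rowVec_mul, leviProj_rowSec hs0]
    by_cases hg : rowVec g ∈ unitRows F k
    · congr 1
      change ψ (rowRetract F hc _) = φ (rowRetract F hc _)
      rw [rowRetract_vecMul hc hg hs, h]
    · rw [baseFun_of_notMem x hg, smul_zero, smul_zero]
  rw [rowFunctional_apply, rowFunctional_apply, h1]
  have h2 := hl ⟨(rowSec s).1, (rowSec s).2, hsH⟩
    (rowSmul (φ.comap ⟨_, continuous_rowRetract hc⟩) (baseVec hθ hσ x))
  rw [PosChar.integralRowGroup_eq_one hH hc ⟨s, hs, rfl⟩ hsH, Complex.ofReal_one, one_mul] at h2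
  exact h2

/-- A linear form in `Hom_{P ∩ H}(Φ⁺ σ, χ)` takes proportional values at the restrictions of a
base vector to clopen sets of rows, with a factor independent of the form and the vector. -/
lemma exists_volume (hθ : Continuous θ) (hθ1 : ∃ x, θ x ≠ 1) (hσ : IsSmoothRep σ)
    (hH : IsBlockGroup c H) (hc : ¬ c k) (hc1 : c (k + 1)) (χ : PosChar ↥(mirabolic F (k + 2) ⊓ H))
    {S : Set (Fin (k + 1) → F)} (hS : IsClopen S) :
    ∃ m : ℝ, (lastVec F k ∈ S → 0 < m) ∧ ∀ l ∈ homChar (phiPlus θ σ) χ, ∀ x : V,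
      l (rowCut hS (baseVec hθ hσ x)) = m * l (baseVec hθ hσ x) := by
  have hS' : IsClopen {γ : integralRowGroup F hc | rowVec γ.1 ∈ S} :=
    hS.preimage (continuous_rowVec.comp continuous_subtype_val)
  obtain ⟨m, hm, hμ⟩ := exists_average hS'
  refine ⟨m, fun h => hm ⟨1, by simpa [rowVec_one] using h⟩, fun l hl x => ?_⟩
  have h1 := hμ (rowFunctional hc l (baseVec hθ hσ x)) (rowFunctional_translate hθ hσ hH hc hl x)
  have h2 : rowFunctional hc l (baseVec hθ hσ x) 1 = l (baseVec hθ hσ x) := by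
    rw [rowFunctional_apply]
    exact congrArg l (one_rowSmul _)
  rw [h2] at h1
  rw [← h1, rowFunctional_apply, ← sub_eq_zero, ← map_sub]
  refine eq_zero_of_vanishing hθ hθ1 hH hc1 hl _ fun g hg => ?_
  change (rowCut hS (baseVec hθ hσ x)).1 g - (rowSmul _ (baseVec hθ hσ x)).1 g = 0
  rw [rowCut, rowSmul_apply, rowSmul_apply, ← sub_smul, baseVec_apply]
  by_cases hgE : rowVec g ∈ unitRows F k
  · have h3 : rowVec (rowRetract F hc (rowVec g)).1 = rowVec g := by
      rw [coe_rowRetract hc hgE, blockProj_of_mem hg, rowVec_rowSec (ne_zero_of_mem_unitRows hgE)]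
    have h4 : LocallyConstant.charFn ℂ hS (rowVec g) =
        LocallyConstant.charFn ℂ hS' (rowRetract F hc (rowVec g)) := by
      rw [LocallyConstant.coe_charFn, LocallyConstant.coe_charFn]
      have h5 : rowRetract F hc (rowVec g) ∈ {γ : integralRowGroup F hc | rowVec γ.1 ∈ S} ↔
          rowVec g ∈ S := by rw [Set.mem_ofPred_eq, h3]
      by_cases hgS : rowVec g ∈ S
      · rw [Set.indicator_of_mem hgS, Set.indicator_of_mem (h5.2 hgS)]
        rfl
      · rw [Set.indicator_of_notMem hgS, Set.indicator_of_notMem fun h => hgS (h5.1 h)]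
    rw [h4]
    exact (congrArg (· • _) (sub_self _)).trans (zero_smul _ _)
  · rw [baseFun_of_notMem x hgE, smul_zero]

end Volume

section Main

variable {F : Type*} [Field F] [ValuativeRel F] [TopologicalSpace F] [IsNonarchimedeanLocalField F]
  {θ : AddChar F Circle} {k : ℕ} {V : Type*} [AddCommGroup V] [Module ℂ V]
  {σ : Representation ℂ (mirabolic F (k + 1)) V}
  {c : ℕ → Prop} {H : Subgroup (GL (Fin (k + 2)) F)} {H' : Subgroup (GL (Fin (k + 1)) F)}
  {χ : PosChar ↥(mirabolic F (k + 2) ⊓ H)}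

/-- A linear form in `Hom_{P ∩ H}(Φ⁺ σ, χ)` is determined by its values at the base vectors. -/
lemma eq_zero_of_baseVec_eq_zero (hθ : Continuous θ) (hθ1 : ∃ x, θ x ≠ 1) (hσ : IsSmoothRep σ)
    (hH : IsBlockGroup c H) (hc : ¬ c k) (hc1 : c (k + 1)) {l : Module.Dual ℂ (PhiPlusSpace θ σ)}
    (hl : l ∈ homChar (phiPlus θ σ) χ) (h0 : ∀ x, l (baseVec hθ hσ x) = 0) : l = 0 := by
  ext f
  refine eq_zero_of_locally_eq_zero l f fun g hg => ?_
  by_cases hgX : rowVec g ∈ blockRows F k c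
  · obtain ⟨h, hhH, hh⟩ := exists_rowVec_eq hH hc hgX (rowVec_ne_zero g)
    refine ⟨stableRows f h, isClopen_stableRows f h, hh ▸ rowVec_mem_stableRows f h,
      fun W hW hsub => ?_⟩
    have h1 := hl ⟨h.1, h.2, hhH⟩ (rowCut hW f)
    have h2 : l (phiPlus θ σ h (rowCut hW f)) = 0 := by
      rw [phiPlus_rowCut hθ hσ f h hW hsub]
      obtain ⟨m, -, hm⟩ := exists_volume hθ hθ1 hσ hH hc hc1 χ
        (hW.preimage (continuous_vecMul (leviProj (k + 1) h)))
      rw [hm l hl, h0, mul_zero]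
    have h3 : (χ.toHom ⟨h.1, h.2, hhH⟩ : ℂ) ≠ 0 := by exact_mod_cast (χ.pos _).ne'
    exact (mul_eq_zero.1 (h1.symm.trans h2)).resolve_left h3
  · obtain ⟨i, hi, hgi⟩ : ∃ i : Fin (k + 1), c i ∧ rowVec g i ≠ 0 := by
      by_contra! h
      exact hgX h
    obtain ⟨x, hx⟩ := id hθ1
    set a : F := (rowVec g i)⁻¹ * x
    have hloc : IsLocallyConstant fun r : Fin (k + 1) → F => θ (r i * a) :=
      (isLocallyConstant_addChar hθ).comp_continuous
        (by fun_prop : Continuous fun r : Fin (k + 1) → F => r i * a)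
    refine ⟨{r | θ (r i * a) ≠ 1}, (hloc.isClopen_fiber 1).compl, by simpa [a, hgi] using hx,
      fun W hW hsub => eq_zero_of_vanishing hθ hθ1 hH hc1 hl _ fun g hg => ?_⟩
    rw [rowCut_apply, if_neg]
    exact fun h => hsub h (by simp [hg i hi])

lemma baseFun_affine (h : mirabolic F (k + 1)) :
    ∃ d : ℝ, 0 < d ∧ ∀ x, baseFun θ σ x (affine h.1 0) = (d : ℂ) • σ h x := by
  have hy : affine h.1 0 ∈ mirabolicUnip F (k + 1) := by
    change leviProj (k + 1) (affine h.1 0) ∈ mirabolic F (k + 1)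
    rw [leviProj_affine]
    exact h.2
  refine ⟨NNReal.sqrt (modulus (unip F (k + 1)) (affine h.1 0)),
    NNReal.coe_pos.2 (NNReal.sqrt_pos.2 (modulus_pos _)), fun x => ?_⟩
  have h1 := baseFun_mul_rowSec (θ := θ) (σ := σ) x ⟨_, hy⟩ lastVec_mem_unitRows
  rw [rowSec_lastVec, mul_one] at h1
  rw [h1]
  change ((((NNReal.sqrt (modulus (unip F (k + 1)) (affine h.1 0)) : ℝ) : ℂ) *
    (thetaChar θ k ⟨_, hy⟩ : ℂ)) • σ (projMirabolic (k + 1) ⟨_, hy⟩)) x = _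
  have h3 : projMirabolic (k + 1) ⟨_, hy⟩ = h := Subtype.ext (leviProj_affine _ _)
  have h4 : thetaChar θ k ⟨_, hy⟩ = 1 := by
    change θ (affineMatrix _ _ _ _) = _
    rw [affineMatrix_castSucc_last]
    simp
  rw [h3, h4, Circle.coe_one, mul_one]
  rfl

/-- The values of a linear form in `Hom_{P ∩ H}(Φ⁺ σ, χ)` at the base vectors transform under
`P_{k+1} ∩ H'` by a positive factor independent of the form and the vector. -/
lemma exists_factor (hθ : Continuous θ) (hθ1 : ∃ x, θ x ≠ 1) (hσ : IsSmoothRep σ)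
    (hH : IsBlockGroup c H) (hH' : IsBlockGroup c H') (hc : ¬ c k) (hc1 : c (k + 1))
    (χ : PosChar ↥(mirabolic F (k + 2) ⊓ H)) (h : ↥(mirabolic F (k + 1) ⊓ H')) (x y : V) :
    ∃ a : ℝ, 0 < a ∧ ∀ l ∈ homChar (phiPlus θ σ) χ, ∀ z, z = x ∨ z = y →
      l (baseVec hθ hσ (σ (Subgroup.inclusion inf_le_left h) z)) = a * l (baseVec hθ hσ z) := by
  set h₁ : mirabolic F (k + 1) := Subgroup.inclusion inf_le_left h with hh₁
  set g : mirabolic F (k + 2) := affine h₁.1 0 with hg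
  have hgH : g.1 ∈ H := affine_mem_blockGroup hH ((hH' _).1 h.2.2)
  obtain ⟨d, hd, hdx⟩ := baseFun_affine (θ := θ) (σ := σ) h₁
  have hrow : rowVec g = lastVec F k := by
    rw [← mem_mirabolicUnip_iff]
    change leviProj (k + 1) (affine h₁.1 0) ∈ mirabolic F (k + 1)
    rw [leviProj_affine]
    exact h₁.2
  have hW : IsClopen (stableRows (baseVec hθ hσ x) g ∩ stableRows (baseVec hθ hσ y) g) :=
    (isClopen_stableRows _ _).inter (isClopen_stableRows _ _)
  have hmem : lastVec F k ∈ stableRows (baseVec hθ hσ x) g ∩ stableRows (baseVec hθ hσ y) g := by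
    rw [← hrow]
    exact ⟨rowVec_mem_stableRows _ _, rowVec_mem_stableRows _ _⟩
  obtain ⟨m, hm, hml⟩ := exists_volume hθ hθ1 hσ hH hc hc1 χ hW
  obtain ⟨m', hm', hml'⟩ := exists_volume hθ hθ1 hσ hH hc hc1 χ
    (hW.preimage (continuous_vecMul (leviProj (k + 1) g)))
  have hm0 := hm hmem
  have hm0' : 0 < m' := by
    apply hm'
    have : lastVec F k ᵥ* (leviProj (k + 1) g).val = lastVec F k := by
      conv_rhs => rw [← hrow, ← one_mul g, rowVec_mul, rowVec_one]
    rw [Set.mem_preimage, this]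
    exact hmem
  have hχ := χ.pos ⟨g.1, g.2, hgH⟩
  refine ⟨χ.toHom ⟨g.1, g.2, hgH⟩ * m / (m' * d), by positivity, fun l hl z hz => ?_⟩
  have h1 := hl ⟨g.1, g.2, hgH⟩ (rowCut hW (baseVec hθ hσ z))
  have hsub : stableRows (baseVec hθ hσ x) g ∩ stableRows (baseVec hθ hσ y) g ⊆
      stableRows (baseVec hθ hσ z) g := by
    rcases hz with rfl | rfl
    exacts [Set.inter_subset_left, Set.inter_subset_right]
  have h2 := congrArg l (phiPlus_rowCut hθ hσ (baseVec hθ hσ z) g hW hsub)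
  rw [hml' l hl, baseVec_apply, hdx, map_smul, map_smul, smul_eq_mul] at h2
  rw [hml l hl] at h1
  have h3 := h2.symm.trans h1
  have hm1 : (m' : ℂ) ≠ 0 := by exact_mod_cast hm0'.ne'
  have hd1 : (d : ℂ) ≠ 0 := by exact_mod_cast hd.ne'
  push_cast
  field_simp
  linear_combination h3

end Main

section Character

variable {G : Type*} [Group G] [TopologicalSpace G] [IsTopologicalGroup G] {V : Type*}
  [AddCommGroup V] [Module ℂ V]

lemma exists_mem_homChar {A B : Subgroup G} {π : Representation ℂ A V} (hπ : IsSmoothRep π)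
    (L : Set (Module.Dual ℂ V)) (hL : ∀ (h : ↥(A ⊓ B)) (x y : V), ∃ a : ℝ, 0 < a ∧
      ∀ l ∈ L, ∀ z, z = x ∨ z = y → l (π (Subgroup.inclusion inf_le_left h) z) = a * l z) :
    ∃ χ : PosChar ↥(A ⊓ B), ∀ l ∈ L, l ∈ homChar π χ := by
  by_cases h0 : ∀ l ∈ L, ∀ x, l x = 0
  · exact ⟨⟨1, fun _ => one_pos, continuous_const⟩, fun l hl h v => by simp [h0 l hl]⟩
  push Not at h0
  obtain ⟨l₀, hl₀, x₀, h0⟩ := h0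
  let a (h : ↥(A ⊓ B)) : ℝ := (l₀ (π (Subgroup.inclusion inf_le_left h) x₀) / l₀ x₀).re
  have ha (h : ↥(A ⊓ B)) : 0 < a h ∧ ∀ l ∈ L, ∀ y,
      l (π (Subgroup.inclusion inf_le_left h) y) = a h * l y := by
    have key (y : V) : 0 < a h ∧ ∀ l ∈ L,
        l (π (Subgroup.inclusion inf_le_left h) y) = a h * l y := by
      obtain ⟨b, hb, hbl⟩ := hL h x₀ y
      have : a h = b := by
        simp only [a]
        rw [hbl l₀ hl₀ x₀ (Or.inl rfl), mul_div_cancel_right₀ _ h0, Complex.ofReal_re]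
      rw [this]
      exact ⟨hb, fun l hl => hbl l hl y (Or.inr rfl)⟩
    exact ⟨(key 0).1, fun l hl y => (key y).2 l hl⟩
  let φ : ↥(A ⊓ B) →* ℝ :=
    { toFun := a
      map_one' := by simp [a, h0]
      map_mul' := fun g h => by
        have : l₀ (π (Subgroup.inclusion inf_le_left (g * h)) x₀) = a g * (a h * l₀ x₀) := by
          rw [map_mul, map_mul, Module.End.mul_apply, (ha g).2 l₀ hl₀, (ha h).2 l₀ hl₀]
        rw [(ha (g * h)).2 l₀ hl₀, ← mul_assoc] at this
        exact_mod_cast mul_right_cancel₀ h0 this }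
  have hφ : Continuous φ := by
    refine continuous_of_continuousAt_one φ ?_
    have hc : Continuous (Subgroup.inclusion (inf_le_left : A ⊓ B ≤ A)) :=
      continuous_subtype_val.subtype_mk _
    have h1 := (hc.tendsto 1).eventually (by rw [map_one]; exact hπ.eventually x₀)
    refine ContinuousAt.congr (continuousAt_const (y := (1 : ℝ))) ?_
    filter_upwards [h1] with g hg
    change 1 = a g
    simp [a, hg, h0]
  exact ⟨⟨φ, fun g => (ha g).1, hφ⟩, fun l hl h v => (ha h).2 l hl v⟩

end Character

section Levi

variable {F : Type*} [Field F]

lemma wPerm_lt_iff {p q m : ℕ} (hqp : q ≤ p) (hm : m = p + q ∨ m + 1 = p + q) (i : Fin m) :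
    ((wPerm p q m hqp hm i : ℕ) - (p - q)) % 2 = 0 ↔ (i : ℕ) < p := by
  have h : (wPerm p q m hqp hm i : ℕ) = wFun p q (i + 1) - 1 := rfl
  rw [h, wFun]
  have := i.2
  split_ifs <;> omega

lemma isBlockGroup_subgroupH {p q m : ℕ} (hqp : q ≤ p) (hm : m = p + q ∨ m + 1 = p + q) :
    IsBlockGroup (fun i => (i - (p - q)) % 2 = 0) (subgroupH F p q m hqp hm) := by
  intro g
  set w := wPerm p q m hqp hm with hw
  set W := (Matrix.permMatrixHom (n := Fin m) (R := F)).toHomUnits w with hW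
  have hentry (i j : Fin m) : (W⁻¹ * g * W) i j = g (w i) (w j) := by
    have h1 : (W⁻¹).val = w.toPEquiv.toMatrix := by
      rw [hW, ← map_inv]
      change (w⁻¹)⁻¹.toPEquiv.toMatrix = _
      rw [inv_inv]
    have h2 : W.val = w.symm.toPEquiv.toMatrix := rfl
    change (W⁻¹.val * g.val * W.val) i j = g.val (w i) (w j)
    rw [h1, h2, PEquiv.toMatrix_toPEquiv_mul, PEquiv.mul_toMatrix_toPEquiv]
    rfl
  have hmem : g ∈ subgroupH F p q m hqp hm ↔ W⁻¹ * g * W ∈ stdLevi F p m := by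
    rw [subgroupH, Subgroup.mem_map_equiv]
    simp [← hw, ← hW, MulAut.conj_symm_apply]
  rw [hmem]
  change (∀ i j : Fin m, ¬((i : ℕ) < p ↔ (j : ℕ) < p) → _) ↔ _
  simp only [hentry, ← wPerm_lt_iff hqp hm]
  constructor
  · intro h i j hij
    have := h (w.symm i) (w.symm j)
    simp only [← hw, Equiv.apply_symm_apply] at this
    exact this hij
  · exact fun h i j hij => h _ _ hij

end Levi

end PAdic

end

theorem mainTheorem4 {F : Type*} [Field F] [ValuativeRel F] [TopologicalSpace F]
    [IsNonarchimedeanLocalField F]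
    (θ : AddChar F Circle) (hθ : Continuous θ) (hθ1 : ∃ x, θ x ≠ 1)
    (p q k : ℕ) (hq : 1 ≤ q) (hqp : q ≤ p) (hn : p + q = k + 3)
    {V : Type*} [AddCommGroup V] [Module ℂ V]
    (σ : Representation ℂ (PAdic.mirabolic F (k + 1)) V) (hσ : PAdic.IsSmoothRep σ)
    (χ : PAdic.PosChar ↥(PAdic.mirabolic F (k + 2) ⊓
      PAdic.subgroupH F p q (k + 2) hqp (Or.inr hn.symm))) :
    ∃ χ' : PAdic.PosChar ↥(PAdic.mirabolic F (k + 1) ⊓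
        PAdic.subgroupH F (p - 1) (q - 1) (k + 1) (by omega) (Or.inl (by omega))),
      ∃ Λ : PAdic.homChar (PAdic.phiPlus θ σ) χ →ₗ[ℂ] PAdic.homChar σ χ',
        Function.Injective Λ := by
  have hH := PAdic.isBlockGroup_subgroupH (F := F) hqp (Or.inr hn.symm : k + 2 = _ ∨ _)
  have hH' := PAdic.isBlockGroup_subgroupH (F := F) (p := p - 1) (q := q - 1) (m := k + 1)
    (by omega) (Or.inl (by omega))
  rw [show p - 1 - (q - 1) = p - q by omega] at hH'
  have hc1 : (k + 1 - (p - q)) % 2 = 0 := by omega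
  rcases Nat.lt_or_ge 1 q with hq2 | hq1
  · have hc : ¬ (k - (p - q)) % 2 = 0 := by omega
    obtain ⟨χ', hχ'⟩ := PAdic.exists_mem_homChar (B := PAdic.subgroupH F (p - 1) (q - 1) (k + 1)
      (by omega) (Or.inl (by omega))) hσ
      {l | ∃ l' ∈ PAdic.homChar (PAdic.phiPlus θ σ) χ, l = l' ∘ₗ PAdic.baseVec hθ hσ}
      fun h x y => by
        obtain ⟨a, ha, hal⟩ := PAdic.exists_factor hθ hθ1 hσ hH hH' hc hc1 χ h x y
        refine ⟨a, ha, ?_⟩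
        rintro _ ⟨l, hl, rfl⟩ z hz
        exact hal l hl z hz
    refine ⟨χ', (((PAdic.baseVec hθ hσ).lcomp ℂ ℂ).domRestrict _).codRestrict _
      fun l => hχ' _ ⟨l.1, l.2, rfl⟩, ?_⟩
    rw [injective_iff_map_eq_zero]
    intro l hl
    refine Subtype.ext (PAdic.eq_zero_of_baseVec_eq_zero hθ hθ1 hσ hH hc hc1 l.2 fun x => ?_)
    exact LinearMap.congr_fun (congrArg Subtype.val hl) x
  · refine ⟨⟨1, fun _ => one_pos, continuous_const⟩, 0, fun l₁ l₂ _ => ?_⟩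
    have key (l : PAdic.homChar (PAdic.phiPlus θ σ) χ) : l = 0 := by
      refine Subtype.ext (LinearMap.ext fun f =>
        PAdic.eq_zero_of_vanishing hθ hθ1 hH hc1 l.2 f fun g hg => ?_)
      refine (PAdic.rowVec_ne_zero g (funext fun i => hg i ?_)).elim
      have := i.2
      change ((i : ℕ) - (p - q)) % 2 = 0
      omega
    rw [key l₁, key l₂]
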